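/- **Setting.** A polymatrix game $G$ with $n$ players and $m\ge 1$ pure strategies per player consists of a graph on the players and, for every edge $ij$, two $m\times m$ payoff matrices $A_{ij}$ (for $i$) and $A_{ji}$ (for $j$). For a strategy profile $s$, the pure strategy payoffs of $i$ are $p_i(s)=\sum_{j\in N(i)}A_{ij}s_j$ and the expected payoff of $i$ is $s_i\cdot p_i(s)$; all payoffs of a player in $G$ lie in $[0,1]$. The profile $s$ is an $\varepsilon$-NE if $s_i\cdot p_i(s)\ge\max p_i(s)-\varepsilon$ for all $i$. A strategy is $k$-uniform if it plays uniformly over a multiset of $k$ pure strategies. For a set $F$ of players let $G_F$ be the subgame of $G$ that keeps the edges with at least one endpoint in $F$. An OVD (one variable decomposable) constraint on $G$ assigns a number $g_F(s)$ to every $F$ and every profile $s$ such that: $g_\emptyset$ is constant; for $v\notin F$, $g_{F\cup\{v\}}(s)$ is a function $\mathrm{add}$ of $F$, $v$, the strategies of $v$ and of its neighbours outside $F$, and $g_F(s)$; and for disjoint $F_1,F_2$ without edges between them, $g_{F_1\cup F_2}(s)$ is a function $\mathrm{merge}$ of $F_1,F_2,g_{F_1}(s),g_{F_2}(s)$. Write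 $g$ for the value on $G$ itself, where $F$ is the set of all players. The constraint is linear in the payoffs, with coefficients $c_i,d_{i,l}\in\mathbb R$, if for all $F$ and $s$, $g_F(s)=\sum_i\big(c_i\,u_i+\sum_l d_{i,l}\,q_{i,l}\big)$, where $u_i$ and $q_{i,l}$ are the expected payoff of $i$ and its payoff for pure strategy $l$ in $G_F$ under $s$. **Algorithm.** Input: a nice tree decomposition of the graph with empty root bag, $\varepsilon>0$, $k\ge1$, and an OVD constraint. For a node $v$ with bag $X_v$, let $F_v$ be the set of players that occur in bags of the subtree of $v$ but not in $X_v$. From the leaves up, the algorithm computes for each node $v$ a table $C(v)$ of triples $(s,p,x)$: strategies and payoff vectors for the players in $X_v$, and a number. * Leaf: all choices of $k$-uniform strategies for $X_v$, with $p=0$ and $x=g_\emptyset$. * A node introducing $i$: every entry of the child, extended by every $k$-uniform strategy of $i$, with $p_i=0$ and $x$ unchanged. * A node forgetting $i$, with child $u$: every entry of $C(u)$ for which $h:=p_i+\sum_{j\in X_v\cap N(i)}A_{ij}s_j$ satisfies $s_i\cdot h\ge\max h-\varepsilon$. Then $s_i,p_i$ are deleted; for $j\in X_v$ the vector $p_j$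 (increased by $A_{ji}s_i$ if $j\in N(i)$) is rounded entrywise to the closest multiple of $\varepsilon/(2n)$; and $x$ is replaced by $\mathrm{add}(F_u,i,\cdot,x)$, evaluated at the strategies of $i$ and of its neighbours outside $F_u$. * A join node: every pair of entries of the two children $u_1,u_2$ with the same $s$; the payoff vectors are added, and $x=\mathrm{merge}(F_{u_1},F_{u_2},x_1,x_2)$. At every node, among entries with equal $(s,p)$ only those with the highest $x$ are kept. The algorithm returns a profile by starting from an entry of the root table, going down the tree and choosing entries of the children that generate the chosen entry, and giving each player the strategy that it has when it is forgotten (ties between generating entries are broken arbitrarily). **Theorem.** For every game and all coefficients $c,d$ (social welfare is $c_i=1$, $d=0$) there is an OVD constraint that is linear in the payoffs with these coefficients. Moreover there is an absolute constant $C$ such that the following holds for every such game $G$, every OVD constraint on $G$ that is linear in the payoffs with coefficients $c,d$, every nice tree decomposition of the graph of $G$ with empty root bag, every $\varepsilon>0$ and every integer $k\ge1$ with $k\ge 128\cdot\frac{\ln m+\ln n-\ln\varepsilon+\ln 8}{\varepsilon^2}$. Every profile returned by the algorithm is a $k$-uniform $1.5\varepsilon$-NE. For every $\varepsilon/8$-NE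 $s'$ of $G$, $k$-uniform or not, the algorithm returns a profile, and every profile $s$ that it can return satisfies $$g(s)\ \ge\ g(s')-C\Big(\sum_i\big(|c_i|+\sum_l|d_{i,l}|\big)\Big)\varepsilon .$$ -/

import Mathlib

/-! # Polymatrix games, nice tree decompositions, and the constrained dynamic program -/

noncomputable section

/-- An assignment of a real vector over the `m` pure strategies to each of the `n` players.
It is a strategy profile when every vector is a probability distribution (`IsProfile`); the zero
vector marks a player to whom no strategy is assigned. -/
abbrev Assignment (n m : ℕ) : Type := Fin n → Fin m → ℝ

/-- A polymatrix game with `n` players and `m` pure strategies per player: on every edge `ij` of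
the interaction graph, `payoff i j` is the payoff matrix of `i` (rows: strategies of `i`, columns:
strategies of `j`).  The matrices `payoff i j` with `ij` not an edge are never used. -/
structure PolymatrixGame (n m : ℕ) where
  graph : SimpleGraph (Fin n)
  payoff : Fin n → Fin n → Matrix (Fin m) (Fin m) ℝ

/-- Every player has a mixed strategy. -/
def IsProfile {n m : ℕ} (s : Assignment n m) : Prop :=
  ∀ i, s i ∈ stdSimplex ℝ (Fin m)

/-- `s` plays uniformly over a multiset of `k` pure strategies. -/
def IsKUniform {m : ℕ} (k : ℕ) (s : Fin m → ℝ) : Prop :=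
  ∃ S : Multiset (Fin m), S.card = k ∧ ∀ l, s l = (S.count l : ℝ) / (k : ℝ)

namespace PolymatrixGame

variable {n m : ℕ} (G : PolymatrixGame n m)

open Classical in
/-- The payoff vector that `i` obtains from the players in `S` under `s`: the sum of `A_ij s_j`
over the neighbours `j ∈ S` of `i`. -/
def payoffFrom (S : Finset (Fin n)) (s : Assignment n m) (i : Fin n) : Fin m → ℝ :=
  ∑ j ∈ S with G.graph.Adj i j, (G.payoff i j).mulVec (s j)

/-- The vector of pure strategy payoffs of player `i` under `s`. -/
def purePayoff (s : Assignment n m) (i : Fin n) : Fin m → ℝ :=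
  G.payoffFrom Finset.univ s i

/-- The expected payoff of player `i` under `s`. -/
def expectedPayoff (s : Assignment n m) (i : Fin n) : ℝ :=
  dotProduct (s i) (G.purePayoff s i)

/-- All payoffs that a player can obtain lie in `[0, 1]`. -/
def IsNormalised : Prop :=
  ∀ s, IsProfile s → ∀ i l, 0 ≤ G.purePayoff s i l ∧ G.purePayoff s i l ≤ 1

/-- `s` is an `ε`-Nash equilibrium: no player has regret larger than `ε`. -/
def IsApproxNE (ε : ℝ) (s : Assignment n m) : Prop :=
  IsProfile s ∧ ∀ i l, G.purePayoff s i l - ε ≤ G.expectedPayoff s i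

/-- The subgame that keeps exactly the edges with at least one endpoint in `F`. -/
def subgame (F : Finset (Fin n)) : PolymatrixGame n m where
  graph :=
    { Adj := fun i j => G.graph.Adj i j ∧ (i ∈ F ∨ j ∈ F)
      symm := ⟨fun _ _ h => ⟨h.1.symm, h.2.symm⟩⟩
      loopless := ⟨fun _ h => G.graph.irrefl h.1⟩ }
  payoff := G.payoff

/-- The linear function of the payoffs with coefficient `c i` at the expected payoff of player `i`
and coefficient `d i l` at the payoff of pure strategy `l` of player `i`.
Social welfare is the case `c = 1`, `d = 0`. -/
def linearPayoff (c : Fin n → ℝ) (d : Fin n → Fin m → ℝ) (s : Assignment n m) : ℝ :=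
  ∑ i, (c i * G.expectedPayoff s i + ∑ l, d i l * G.purePayoff s i l)

open Classical in
/-- The part of `s` that is relevant to the edges at `v` that do not lead into `F`: the strategies
of `v` and of its neighbours outside `F`; all other strategies are erased. -/
def localPart (F : Finset (Fin n)) (v : Fin n) (s : Assignment n m) : Assignment n m :=
  fun j => if j = v ∨ (G.graph.Adj v j ∧ j ∉ F) then s j else 0

end PolymatrixGame

/-- A one variable decomposable constraint on the game `G`.  `value F s` is the number that the
constraint assigns to the profile `s` in the subgame belonging to the set of players `F` (the edges
with an endpoint in `F`), and `value univ s` is the number assigned to `s` in `G` itself.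

When a player `v` is added to `F`, the new number is a function of `F`, of `v`, of the strategies
of `v` and of those of its neighbours to which it gets connected, and of the old number; when two
sets of players without edges between them are merged, the new number is a function of the two
sets and the two old numbers. -/
structure OVDConstraint {n m : ℕ} (G : PolymatrixGame n m) where
  value : Finset (Fin n) → Assignment n m → ℝ
  emptyValue : ℝ
  add : Finset (Fin n) → Fin n → Assignment n m → ℝ → ℝ
  merge : Finset (Fin n) → Finset (Fin n) → ℝ → ℝ → ℝ
  value_empty : ∀ s, IsProfile s → value ∅ s = emptyValue
  value_add : ∀ F v s, IsProfile s → v ∉ F →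
    value (insert v F) s = add F v (G.localPart F v s) (value F s)
  value_merge : ∀ F₁ F₂ s, IsProfile s → Disjoint F₁ F₂ →
    (∀ i ∈ F₁, ∀ j ∈ F₂, ¬ G.graph.Adj i j) →
    value (F₁ ∪ F₂) s = merge F₁ F₂ (value F₁ s) (value F₂ s)

/-- The constraint function is, on every subgame, the linear function of the payoffs of that
subgame with coefficients `c` and `d`. -/
def OVDConstraint.IsLinear {n m : ℕ} {G : PolymatrixGame n m} (K : OVDConstraint G)
    (c : Fin n → ℝ) (d : Fin n → Fin m → ℝ) : Prop :=
  ∀ F s, IsProfile s → K.value F s = (G.subgame F).linearPayoff c d s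

/-- Rooted binary trees with the four kinds of nodes of a nice tree decomposition: a leaf with a
given bag, a node that adds a vertex to the bag of its child, a node that removes a vertex from the
bag of its child, and a node with two children. -/
inductive NiceTree (n : ℕ) : Type
  | start (X : Finset (Fin n)) : NiceTree n
  | introduce (i : Fin n) (t : NiceTree n) : NiceTree n
  | forget (i : Fin n) (t : NiceTree n) : NiceTree n
  | join (t₁ t₂ : NiceTree n) : NiceTree n

namespace NiceTree

variable {n : ℕ}

/-- The bag of the root. -/
def bag : NiceTree n → Finset (Fin n)
  | start X => X
  | introduce i t => insert i t.bag
  | forget i t => t.bag.erase i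
  | join t₁ _ => t₁.bag

/-- The conditions that make the nodes what their names say: an introduced vertex is new, a
forgotten vertex was present, and the children of a join node have the same bag. -/
def WellFormed : NiceTree n → Prop
  | start _ => True
  | introduce i t => i ∉ t.bag ∧ t.WellFormed
  | forget i t => i ∈ t.bag ∧ t.WellFormed
  | join t₁ t₂ => t₁.bag = t₂.bag ∧ t₁.WellFormed ∧ t₂.WellFormed

/-- The union of all bags. -/
def players : NiceTree n → Finset (Fin n)
  | start X => X
  | introduce i t => insert i t.players
  | forget _ t => t.players
  | join t₁ t₂ => t₁.players ∪ t₂.players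

/-- The players that occur in the tree but not in the bag of its root. -/
def forgotten (t : NiceTree n) : Finset (Fin n) :=
  t.players \ t.bag

/-- The bag of the node with a given address.  The root has address `[]`, an only child is reached
by `false`, the two children of a join node by `false` and `true`. -/
def bagAt : NiceTree n → List Bool → Option (Finset (Fin n))
  | t, [] => some t.bag
  | introduce _ t, false :: a => t.bagAt a
  | forget _ t, false :: a => t.bagAt a
  | join t₁ _, false :: a => t₁.bagAt a
  | join _ t₂, true :: a => t₂.bagAt a
  | _, _ :: _ => none

/-- The node with address `b` is on the tree path between those with addresses `a` and `a'`: it is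
an ancestor of one of them (or equal to it), and every common ancestor is an ancestor of `b`. -/
def OnPath (a b a' : List Bool) : Prop :=
  (b <+: a ∨ b <+: a') ∧ ∀ e : List Bool, e <+: a → e <+: a' → e <+: b

/-- The tree with its bags is a nice tree decomposition of the graph `H`. -/
structure IsNiceTreeDecomposition (t : NiceTree n) (H : SimpleGraph (Fin n)) : Prop where
  wellFormed : t.WellFormed
  covers_vertices : ∀ v, ∃ a X, t.bagAt a = some X ∧ v ∈ X
  covers_edges : ∀ u v, H.Adj u v → ∃ a X, t.bagAt a = some X ∧ u ∈ X ∧ v ∈ X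
  connected : ∀ a b a' X Y Z, t.bagAt a = some X → t.bagAt b = some Y → t.bagAt a' = some Z →
    OnPath a b a' → X ∩ Z ⊆ Y

end NiceTree

/-- An entry of the dynamic programming table at a node with bag `X`: strategies and payoff vectors
for the players of `X` (and `0` for all other players), and the value of the constraint. -/
@[ext]
structure Candidate (n m : ℕ) where
  strat : Assignment n m
  pay : Assignment n m
  val : ℝ

/-- Rounding to the closest integer multiple of `δ`. -/
def roundTo (δ x : ℝ) : ℝ := δ * (round (x / δ) : ℝ)

namespace ConstrainedAlgorithm

variable {n m : ℕ} {G : PolymatrixGame n m}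

open Classical in
/-- `c` may be listed at a start node with bag `X`. -/
def StartStep (K : OVDConstraint G) (k : ℕ) (X : Finset (Fin n)) (c : Candidate n m) : Prop :=
  (∀ i, if i ∈ X then IsKUniform k (c.strat i) else c.strat i = 0) ∧
    c.pay = 0 ∧ c.val = K.emptyValue

/-- `c` is produced from `c'` when player `i` is introduced with some `k`-uniform strategy. -/
def IntroduceStep (k : ℕ) (i : Fin n) (c' c : Candidate n m) : Prop :=
  ∃ σ : Fin m → ℝ, IsKUniform k σ ∧
    c.strat = Function.update c'.strat i σ ∧ c.pay = Function.update c'.pay i 0 ∧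
    c.val = c'.val

/-- The payoff vector that the algorithm holds for player `i`, who is about to be forgotten: the
stored payoffs from the players already forgotten, plus the payoffs from the players in the new
bag `X`. -/
def heldPayoff (G : PolymatrixGame n m) (X : Finset (Fin n)) (c : Candidate n m) (i : Fin n) :
    Fin m → ℝ :=
  c.pay i + G.payoffFrom X c.strat i

/-- The test that player `i` is `ε`-happy. -/
def IsHappy (G : PolymatrixGame n m) (ε : ℝ) (X : Finset (Fin n)) (c : Candidate n m)
    (i : Fin n) : Prop :=
  ∀ l, heldPayoff G X c i l - ε ≤ dotProduct (c.strat i) (heldPayoff G X c i)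

open Classical in
/-- `c` is produced from the entry `c'` of the table of the child `t` when player `i` is forgotten:
`i` passes the test, the strategy and payoff vector of `i` are discarded, the payoff vectors of the
remaining players are updated by what they obtain from `i` and rounded to the closest multiple of
`ε / (2 n)`, and `i` is added to the value of the constraint. -/
def ForgetStep (K : OVDConstraint G) (ε : ℝ) (i : Fin n) (t : NiceTree n)
    (c' c : Candidate n m) : Prop :=
  IsHappy G ε (t.bag.erase i) c' i ∧
    c.strat = Function.update c'.strat i 0 ∧
    c.pay = (fun j l => if j ∈ t.bag.erase i then
      roundTo (ε / (2 * n)) (c'.pay j l + G.payoffFrom {i} c'.strat j l) else 0) ∧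
    c.val = K.add t.forgotten i (G.localPart t.forgotten i c'.strat) c'.val

/-- `c` is produced at a join node with children `t₁` and `t₂` from the entries `c₁` and `c₂` of
their tables. -/
def JoinStep (K : OVDConstraint G) (t₁ t₂ : NiceTree n) (c₁ c₂ c : Candidate n m) : Prop :=
  c₁.strat = c₂.strat ∧ c.strat = c₁.strat ∧ c.pay = c₁.pay + c₂.pay ∧
    c.val = K.merge t₁.forgotten t₂.forgotten c₁.val c₂.val

/-- Among candidates that agree on strategies and payoff vectors, keep the one with the highest
value of the constraint. -/
def keepBest (D : Set (Candidate n m)) : Set (Candidate n m) :=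
  {c ∈ D | ∀ c' ∈ D, c'.strat = c.strat → c'.pay = c.pay → c'.val ≤ c.val}

/-- First phase: the table computed at the root of the tree. -/
def table (K : OVDConstraint G) (ε : ℝ) (k : ℕ) : NiceTree n → Set (Candidate n m)
  | .start X => keepBest {c | StartStep K k X c}
  | .introduce i t => keepBest {c | ∃ c' ∈ table K ε k t, IntroduceStep k i c' c}
  | .forget i t => keepBest {c | ∃ c' ∈ table K ε k t, ForgetStep K ε i t c' c}
  | .join t₁ t₂ => keepBest {c | ∃ c₁ ∈ table K ε k t₁, ∃ c₂ ∈ table K ε k t₂,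
      JoinStep K t₁ t₂ c₁ c₂ c}

open Classical in
/-- Second phase: `s` is an assignment of strategies to the forgotten players of the tree that can
result from unrolling the entry `c` of the table at its root, by finding at every node entries of
the tables of the children from which the chosen entry was produced. -/
def Unrolls (K : OVDConstraint G) (ε : ℝ) (k : ℕ) :
    NiceTree n → Candidate n m → Assignment n m → Prop
  | .start _, _, s => s = 0
  | .introduce i t, c, s => ∃ c' ∈ table K ε k t, IntroduceStep k i c' c ∧ Unrolls K ε k t c' s
  | .forget i t, c, s => ∃ c' ∈ table K ε k t, ForgetStep K ε i t c' c ∧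
      ∃ s', Unrolls K ε k t c' s' ∧ s = Function.update s' i (c'.strat i)
  | .join t₁ t₂, c, s => ∃ c₁ ∈ table K ε k t₁, ∃ c₂ ∈ table K ε k t₂, JoinStep K t₁ t₂ c₁ c₂ c ∧
      ∃ s₁ s₂, Unrolls K ε k t₁ c₁ s₁ ∧ Unrolls K ε k t₂ c₂ s₂ ∧
        s = fun j => if j ∈ t₁.forgotten then s₁ j else s₂ j

/-- `s` can be returned by the algorithm, run on the nice tree decomposition `t` with parameters
`ε` and `k`.  Different outputs are possible only because several entries of the tables may
generate the same entry. -/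
def Returns (K : OVDConstraint G) (ε : ℝ) (k : ℕ) (t : NiceTree n) (s : Assignment n m) : Prop :=
  ∃ c ∈ table K ε k t, Unrolls K ε k t c s

end ConstrainedAlgorithm

end

/-!
The payoffs of a `k`-uniform profile whose players are sampled independently from a profile `s'`
are averages of independent variables in `[0, 1]`. By Hoeffding's inequality and a union bound over
the `n * (m + 1)` relevant payoffs, some sample `s₁` changes every pure payoff by at most `ε / 8`
and every expected payoff by at most `ε / 4`. If `s'` is an `ε / 8`-equilibrium, then `s₁` is an
`ε / 2`-equilibrium, and passing from `s'` to `s₁` costs at most `ε / 4` per unit of coefficient.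

Each forgotten player contributes a rounding error of at most `ε / (4 * n)` to a stored payoff, so
the test at a forget node sees all payoffs up to `ε / 4`. Hence a player who passes has regret at
most `3 / 2 * ε`, and no player of an `ε / 2`-equilibrium fails. An entry generated along `s₁` may
be replaced by a better one with the same strategies and payoffs in the bag, but the constraint
sees the forgotten players only through its value, and linear constraints are monotone in these
values; so the value of the entry kept is never below that of `s₁`. The unrolled profile attains
the value of its root entry, because the recursion for the value follows the decomposition.
-/

lemma IsKUniform.mem_stdSimplex {m k : ℕ} (hk : 0 < k) {σ : Fin m → ℝ} (hσ : IsKUniform k σ) :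
    σ ∈ stdSimplex ℝ (Fin m) := by
  obtain ⟨S, hS, hσ⟩ := hσ
  refine ⟨fun l => by rw [hσ]; positivity, ?_⟩
  have hk₀ : (k : ℝ) ≠ 0 := by positivity
  simp_rw [hσ, ← Finset.sum_div]
  rw [div_eq_one_iff_eq hk₀, ← hS, ← Nat.cast_sum]
  simp [Multiset.sum_count_eq_card]

lemma finite_setOf_isKUniform (m k : ℕ) : {σ : Fin m → ℝ | IsKUniform k σ}.Finite := by
  refine (Set.finite_range fun (S : Sym (Fin m) k) (l : Fin m) =>
    ((S : Multiset (Fin m)).count l : ℝ) / (k : ℝ)).subset ?_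
  rintro σ ⟨S, hS, hσ⟩
  exact ⟨⟨S, hS⟩, funext fun l => (hσ l).symm⟩

lemma abs_roundTo_sub_le {δ : ℝ} (hδ : 0 < δ) (x : ℝ) : |roundTo δ x - x| ≤ δ / 2 := by
  have hround : roundTo δ x - x = -(δ * (x / δ - round (x / δ))) := by
    rw [roundTo, mul_sub, mul_div_cancel₀ x hδ.ne', neg_sub]
  rw [hround, abs_neg, abs_mul, abs_of_pos hδ]
  linarith [mul_le_mul_of_nonneg_left (abs_sub_round (x / δ)) hδ.le]

section Regret

variable {ι : Type*} [Fintype ι] {σ p q : ι → ℝ} {η : ℝ}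

lemma abs_dotProduct_sub_le (hσ : σ ∈ stdSimplex ℝ ι) (h : ∀ l, |p l - q l| ≤ η) :
    |σ ⬝ᵥ p - σ ⬝ᵥ q| ≤ η := by
  rw [← dotProduct_sub]
  calc |σ ⬝ᵥ (p - q)| ≤ ∑ l, |σ l * (p - q) l| := Finset.abs_sum_le_sum_abs _ _
    _ ≤ ∑ l, σ l * η := Finset.sum_le_sum fun l _ => by
        rw [abs_mul, abs_of_nonneg (hσ.1 l)]
        exact mul_le_mul_of_nonneg_left (h l) (hσ.1 l)
    _ = η := by rw [← Finset.sum_mul, hσ.2, one_mul]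

lemma sub_le_dotProduct_of_abs_sub_le (hσ : σ ∈ stdSimplex ℝ ι) (h : ∀ l, |p l - q l| ≤ η)
    {ε : ℝ} (hp : ∀ l, p l - ε ≤ σ ⬝ᵥ p) (l : ι) : q l - (ε + 2 * η) ≤ σ ⬝ᵥ q := by
  have hl := (abs_le.1 (h l)).1
  have hdot := (abs_le.1 (abs_dotProduct_sub_le hσ h)).2
  linarith [hp l]

end Regret

/-! ### Forgotten players in a nice tree decomposition -/

namespace NiceTree

variable {n : ℕ} {H : SimpleGraph (Fin n)} {t t' t₁ t₂ : NiceTree n} {i u v : Fin n}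

lemma bagAt_nil (t : NiceTree n) : t.bagAt [] = some t.bag := by
  cases t <;> rfl

lemma WellFormed.bag_subset_players (ht : t.WellFormed) : t.bag ⊆ t.players := by
  induction t with
  | start X => exact subset_rfl
  | introduce i t ih => exact Finset.insert_subset_insert i (ih ht.2)
  | forget i t ih => exact (Finset.erase_subset i _).trans (ih ht.2)
  | join t₁ t₂ ih₁ _ => exact (ih₁ ht.2.1).trans Finset.subset_union_left

lemma WellFormed.mem_players_of_bagAt (ht : t.WellFormed) {a : List Bool} {X : Finset (Fin n)}
    (ha : t.bagAt a = some X) (hv : v ∈ X) : v ∈ t.players := by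
  fun_induction bagAt t a with
  | case1 t => exact ht.bag_subset_players (Option.some.inj ha ▸ hv)
  | case2 _ i t ih => exact Finset.mem_insert_of_mem (ih ht.2 ha)
  | case3 _ i t ih => exact ih ht.2 ha
  | case4 _ t₁ t₂ ih => exact Finset.mem_union_left _ (ih ht.2.1 ha)
  | case5 _ t₁ t₂ ih => exact Finset.mem_union_right _ (ih ht.2.2 ha)
  | case6 => cases ha

lemma exists_bagAt_of_mem_players (hv : v ∈ t.players) : ∃ a X, t.bagAt a = some X ∧ v ∈ X := by
  induction t with
  | start X => exact ⟨[], X, rfl, hv⟩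
  | introduce i t ih =>
    rcases Finset.mem_insert.1 hv with rfl | hv
    · exact ⟨[], _, rfl, Finset.mem_insert_self v _⟩
    · obtain ⟨a, X, ha, hX⟩ := ih hv
      exact ⟨false :: a, X, ha, hX⟩
  | forget i t ih =>
    obtain ⟨a, X, ha, hX⟩ := ih hv
    exact ⟨false :: a, X, ha, hX⟩
  | join t₁ t₂ ih₁ ih₂ =>
    rcases Finset.mem_union.1 hv with hv | hv
    · obtain ⟨a, X, ha, hX⟩ := ih₁ hv
      exact ⟨false :: a, X, ha, hX⟩
    · obtain ⟨a, X, ha, hX⟩ := ih₂ hv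
      exact ⟨true :: a, X, ha, hX⟩

lemma disjoint_forgotten_bag (t : NiceTree n) : Disjoint t.forgotten t.bag :=
  Finset.sdiff_disjoint

lemma notMem_forgotten (hi : i ∈ t.bag) : i ∉ t.forgotten :=
  Finset.disjoint_right.1 t.disjoint_forgotten_bag hi

lemma forgotten_start (X : Finset (Fin n)) : (start X).forgotten = ∅ :=
  Finset.sdiff_self X

lemma forgotten_introduce (hi : i ∉ t.players) : (introduce i t).forgotten = t.forgotten := by
  ext v
  simp only [forgotten, players, bag, Finset.mem_sdiff, Finset.mem_insert]
  grind

lemma forgotten_forget (ht : (forget i t).WellFormed) :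
    (forget i t).forgotten = insert i t.forgotten := by
  have hi : i ∈ t.players := ht.2.bag_subset_players ht.1
  ext v
  simp only [forgotten, players, bag, Finset.mem_sdiff, Finset.mem_insert, Finset.mem_erase]
  grind

lemma forgotten_join (ht : t₁.bag = t₂.bag) :
    (join t₁ t₂).forgotten = t₁.forgotten ∪ t₂.forgotten := by
  simp only [forgotten, players, bag, ← ht]
  exact Finset.union_sdiff_distrib _ _ _

lemma onPath_of_isPrefix {a b a' : List Bool} (hab : a <+: b) (hba' : b <+: a') :
    OnPath a b a' :=
  ⟨Or.inr hba', fun _ he _ => he.trans hab⟩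

lemma onPath_nil_of_ne {x y : Bool} (hxy : x ≠ y) (a a' : List Bool) :
    OnPath (x :: a) [] (y :: a') := by
  refine ⟨Or.inl (List.prefix_append [] _), fun e he he' => ?_⟩
  cases e with
  | nil => exact List.prefix_rfl
  | cons z e =>
    exact absurd ((List.cons_prefix_cons.1 he).1.symm.trans (List.cons_prefix_cons.1 he').1) hxy

lemma OnPath.cons {a b a' : List Bool} (h : OnPath a b a') (x : Bool) :
    OnPath (x :: a) (x :: b) (x :: a') := by
  refine ⟨by simpa only [List.cons_prefix_cons, true_and] using h.1, fun e he he' => ?_⟩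
  cases e with
  | nil => exact List.prefix_append [] _
  | cons z e =>
    obtain ⟨rfl, hea⟩ := List.cons_prefix_cons.1 he
    exact List.cons_prefix_cons.2 ⟨rfl, h.2 e hea (List.cons_prefix_cons.1 he').2⟩

/-- The conditions on a nice tree decomposition of `H` that are inherited by subtrees: only the
edges at forgotten vertices have to be covered. -/
structure IsPartialDecomposition (t : NiceTree n) (H : SimpleGraph (Fin n)) : Prop where
  wellFormed : t.WellFormed
  covers_edges : ∀ u ∈ t.forgotten, ∀ v, H.Adj u v → ∃ a X, t.bagAt a = some X ∧ u ∈ X ∧ v ∈ X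
  connected : ∀ a b a' X Y Z, t.bagAt a = some X → t.bagAt b = some Y → t.bagAt a' = some Z →
    OnPath a b a' → X ∩ Z ⊆ Y

lemma IsNiceTreeDecomposition.isPartialDecomposition (ht : t.IsNiceTreeDecomposition H) :
    t.IsPartialDecomposition H :=
  ⟨ht.wellFormed, fun u _ => ht.covers_edges u, ht.connected⟩

lemma IsNiceTreeDecomposition.forgotten_eq_univ (ht : t.IsNiceTreeDecomposition H)
    (hbag : t.bag = ∅) : t.forgotten = Finset.univ := by
  rw [forgotten, hbag, Finset.sdiff_empty]
  refine Finset.eq_univ_of_forall fun v => ?_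
  obtain ⟨a, X, ha, hv⟩ := ht.covers_vertices v
  exact ht.wellFormed.mem_players_of_bagAt ha hv

namespace IsPartialDecomposition

lemma mem_players_of_adj (ht : t.IsPartialDecomposition H) (hu : u ∈ t.forgotten)
    (huv : H.Adj u v) : v ∈ t.players := by
  obtain ⟨a, X, ha, -, hv⟩ := ht.covers_edges u hu v huv
  exact ht.wellFormed.mem_players_of_bagAt ha hv

lemma of_child (ht : t.IsPartialDecomposition H) {x : Bool}
    (hbagAt : ∀ a, t.bagAt (x :: a) = t'.bagAt a) (hwf : t'.WellFormed)
    (hforgotten : t'.forgotten ⊆ t.forgotten)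
    (hbelow : ∀ u ∈ t'.forgotten, ∀ a X, t.bagAt a = some X → u ∈ X → ∃ b, a = x :: b) :
    t'.IsPartialDecomposition H where
  wellFormed := hwf
  covers_edges u hu v huv := by
    obtain ⟨a, X, ha, huX, hvX⟩ := ht.covers_edges u (hforgotten hu) v huv
    obtain ⟨b, rfl⟩ := hbelow u hu a X ha huX
    exact ⟨b, X, hbagAt b ▸ ha, huX, hvX⟩
  connected a b a' X Y Z ha hb ha' hab := by
    rw [← hbagAt] at ha hb ha'
    exact ht.connected _ _ _ X Y Z ha hb ha' (hab.cons x)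

lemma notMem_players_of_introduce (ht : (introduce i t).IsPartialDecomposition H) :
    i ∉ t.players := fun hi => by
  obtain ⟨a, X, ha, hX⟩ := exists_bagAt_of_mem_players hi
  exact ht.wellFormed.1 <| ht.connected [] [false] (false :: a) _ _ X rfl (bagAt_nil t) ha
    (onPath_of_isPrefix (List.prefix_append [] _) (List.prefix_append [false] a))
    (Finset.mem_inter.2 ⟨Finset.mem_insert_self i _, hX⟩)

lemma of_introduce (ht : (introduce i t).IsPartialDecomposition H) :
    t.IsPartialDecomposition H := by
  have hi := ht.notMem_players_of_introduce
  refine ht.of_child (x := false) (fun _ => rfl) ht.wellFormed.2 (forgotten_introduce hi).ge ?_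
  rintro u hu (_ | ⟨_ | _, a⟩) X ha huX
  · obtain rfl := Option.some.inj ha
    obtain ⟨hu, hu'⟩ := Finset.mem_sdiff.1 hu
    rcases Finset.mem_insert.1 huX with rfl | huX
    · exact absurd hu hi
    · exact absurd huX hu'
  · exact ⟨a, rfl⟩
  · cases ha

lemma of_forget (ht : (forget i t).IsPartialDecomposition H) : t.IsPartialDecomposition H := by
  refine ht.of_child (x := false) (fun _ => rfl) ht.wellFormed.2
    ((Finset.subset_insert i _).trans (forgotten_forget ht.wellFormed).ge) ?_
  rintro u hu (_ | ⟨_ | _, a⟩) X ha huX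
  · obtain rfl := Option.some.inj ha
    exact absurd (Finset.mem_of_mem_erase huX) (Finset.mem_sdiff.1 hu).2
  · exact ⟨a, rfl⟩
  · cases ha

lemma players_inter_subset_bag (ht : (join t₁ t₂).IsPartialDecomposition H) :
    t₁.players ∩ t₂.players ⊆ t₁.bag := fun v hv => by
  obtain ⟨hv₁, hv₂⟩ := Finset.mem_inter.1 hv
  obtain ⟨a₁, X₁, ha₁, hX₁⟩ := exists_bagAt_of_mem_players hv₁
  obtain ⟨a₂, X₂, ha₂, hX₂⟩ := exists_bagAt_of_mem_players hv₂
  exact ht.connected (false :: a₁) [] (true :: a₂) X₁ t₁.bag X₂ ha₁ rfl ha₂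
    (onPath_nil_of_ne Bool.false_ne_true a₁ a₂) (Finset.mem_inter.2 ⟨hX₁, hX₂⟩)

lemma disjoint_forgotten_players (ht : (join t₁ t₂).IsPartialDecomposition H) :
    Disjoint t₁.forgotten t₂.players := by
  refine Finset.disjoint_left.2 fun v hv₁ hv₂ => ?_
  obtain ⟨hv₁, hvX⟩ := Finset.mem_sdiff.1 hv₁
  exact hvX (ht.players_inter_subset_bag (Finset.mem_inter.2 ⟨hv₁, hv₂⟩))

lemma disjoint_players_forgotten (ht : (join t₁ t₂).IsPartialDecomposition H) :
    Disjoint t₁.players t₂.forgotten := by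
  refine Finset.disjoint_left.2 fun v hv₁ hv₂ => ?_
  obtain ⟨hv₂, hvX⟩ := Finset.mem_sdiff.1 hv₂
  exact hvX (ht.wellFormed.1 ▸ ht.players_inter_subset_bag (Finset.mem_inter.2 ⟨hv₁, hv₂⟩))

lemma disjoint_forgotten (ht : (join t₁ t₂).IsPartialDecomposition H) :
    Disjoint t₁.forgotten t₂.forgotten :=
  ht.disjoint_forgotten_players.mono_right Finset.sdiff_subset

lemma of_join_left (ht : (join t₁ t₂).IsPartialDecomposition H) :
    t₁.IsPartialDecomposition H := by
  refine ht.of_child (x := false) (fun _ => rfl) ht.wellFormed.2.1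
    (Finset.subset_union_left.trans (forgotten_join ht.wellFormed.1).ge) ?_
  rintro u hu (_ | ⟨_ | _, a⟩) X ha huX
  · obtain rfl := Option.some.inj ha
    exact absurd huX (Finset.mem_sdiff.1 hu).2
  · exact ⟨a, rfl⟩
  · exact absurd (ht.wellFormed.2.2.mem_players_of_bagAt ha huX)
      (Finset.disjoint_left.1 ht.disjoint_forgotten_players hu)

lemma of_join_right (ht : (join t₁ t₂).IsPartialDecomposition H) :
    t₂.IsPartialDecomposition H := by
  refine ht.of_child (x := true) (fun _ => rfl) ht.wellFormed.2.2
    (Finset.subset_union_right.trans (forgotten_join ht.wellFormed.1).ge) ?_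
  rintro u hu (_ | ⟨_ | _, a⟩) X ha huX
  · obtain rfl := Option.some.inj ha
    exact absurd (ht.wellFormed.1 ▸ huX) (Finset.mem_sdiff.1 hu).2
  · exact absurd (ht.wellFormed.2.1.mem_players_of_bagAt ha huX)
      (Finset.disjoint_right.1 ht.disjoint_players_forgotten hu)
  · exact ⟨a, rfl⟩

lemma not_adj_of_introduce (ht : (introduce i t).IsPartialDecomposition H) (hv : v ∈ t.forgotten) :
    ¬ H.Adj i v := fun hiv =>
  ht.notMem_players_of_introduce (ht.of_introduce.mem_players_of_adj hv hiv.symm)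

lemma not_adj_of_join (ht : (join t₁ t₂).IsPartialDecomposition H) (hu : u ∈ t₁.forgotten)
    (hv : v ∈ t₂.forgotten) : ¬ H.Adj u v := fun huv =>
  Finset.disjoint_left.1 ht.disjoint_players_forgotten (ht.of_join_left.mem_players_of_adj hu huv)
    hv

lemma mem_forgotten_or_mem_bag_of_adj (ht : (forget i t).IsPartialDecomposition H)
    (hiv : H.Adj i v) : v ∈ t.forgotten ∨ v ∈ t.bag := by
  have hi : i ∈ (forget i t).forgotten := by
    rw [forgotten_forget ht.wellFormed]
    exact Finset.mem_insert_self i _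
  have hv : v ∈ t.players := ht.mem_players_of_adj hi hiv
  by_cases hvX : v ∈ t.bag
  · exact Or.inr hvX
  · exact Or.inl (Finset.mem_sdiff.2 ⟨hv, hvX⟩)

end IsPartialDecomposition

end NiceTree

/-! ### Payoffs in subgames and linear constraints -/

namespace PolymatrixGame

variable {n m : ℕ} (G : PolymatrixGame n m)

lemma payoffFrom_congr {S : Finset (Fin n)} {s s' : Assignment n m} {i : Fin n}
    (h : ∀ j ∈ S, G.graph.Adj i j → s j = s' j) : G.payoffFrom S s i = G.payoffFrom S s' i := by
  classical
  refine Finset.sum_congr rfl fun j hj => ?_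
  obtain ⟨hjS, hij⟩ := Finset.mem_filter.1 hj
  rw [h j hjS hij]

lemma payoffFrom_union {S T : Finset (Fin n)} (h : Disjoint S T) (s : Assignment n m)
    (i : Fin n) : G.payoffFrom (S ∪ T) s i = G.payoffFrom S s i + G.payoffFrom T s i := by
  classical
  unfold payoffFrom
  rw [Finset.filter_union, Finset.sum_union (Finset.disjoint_filter_filter h)]

lemma payoffFrom_insert {S : Finset (Fin n)} {v : Fin n} (hv : v ∉ S) (s : Assignment n m)
    (i : Fin n) : G.payoffFrom (insert v S) s i = G.payoffFrom S s i + G.payoffFrom {v} s i := by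
  rw [Finset.insert_eq, Finset.union_comm,
    payoffFrom_union _ (Finset.disjoint_singleton_right.2 hv)]

lemma payoffFrom_eq_zero {S : Finset (Fin n)} {i : Fin n} (h : ∀ j ∈ S, ¬ G.graph.Adj i j)
    (s : Assignment n m) : G.payoffFrom S s i = 0 := by
  classical
  unfold payoffFrom
  rw [Finset.filter_false_of_mem h, Finset.sum_empty]

lemma purePayoff_eq_payoffFrom {S : Finset (Fin n)} {i : Fin n}
    (h : ∀ j, G.graph.Adj i j → j ∈ S) (s : Assignment n m) :
    G.purePayoff s i = G.payoffFrom S s i := by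
  rw [purePayoff, ← Finset.union_compl S, payoffFrom_union _ disjoint_compl_right,
    G.payoffFrom_eq_zero (S := Sᶜ), add_zero]
  exact fun j hj hij => Finset.mem_compl.1 hj (h j hij)

lemma linearPayoff_congr (c : Fin n → ℝ) (d : Fin n → Fin m → ℝ) {s s' : Assignment n m}
    (h : ∀ i j, G.graph.Adj i j → s i = s' i) :
    G.linearPayoff c d s = G.linearPayoff c d s' := by
  have hpure (i : Fin n) : G.purePayoff s i = G.purePayoff s' i :=
    G.payoffFrom_congr fun j _ hij => h j i hij.symm
  have hexpected (i : Fin n) : G.expectedPayoff s i = G.expectedPayoff s' i := by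
    rw [expectedPayoff, expectedPayoff, hpure]
    by_cases hi : ∃ j, G.graph.Adj i j
    · obtain ⟨j, hij⟩ := hi
      rw [h i j hij]
    · have hzero : G.purePayoff s' i = 0 :=
        G.payoffFrom_eq_zero (fun j _ hij => hi ⟨j, hij⟩) s'
      rw [hzero, dotProduct_zero, dotProduct_zero]
  simp only [linearPayoff, hpure, hexpected]

/-- The game with the payoff matrices of `G` on another interaction graph. -/
def withGraph (H : SimpleGraph (Fin n)) : PolymatrixGame n m where
  graph := H
  payoff := G.payoff

lemma purePayoff_withGraph_sup {H₁ H₂ : SimpleGraph (Fin n)} (h : Disjoint H₁ H₂)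
    (s : Assignment n m) (i : Fin n) :
    (G.withGraph (H₁ ⊔ H₂)).purePayoff s i =
      (G.withGraph H₁).purePayoff s i + (G.withGraph H₂).purePayoff s i := by
  classical
  simp only [purePayoff, payoffFrom, withGraph, SimpleGraph.sup_adj, Finset.filter_or]
  exact Finset.sum_union (Finset.disjoint_filter.2 fun j _ => SimpleGraph.disjoint_left.1 h i j)

lemma linearPayoff_withGraph_sup {H₁ H₂ : SimpleGraph (Fin n)} (h : Disjoint H₁ H₂)
    (c : Fin n → ℝ) (d : Fin n → Fin m → ℝ) (s : Assignment n m) :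
    (G.withGraph (H₁ ⊔ H₂)).linearPayoff c d s =
      (G.withGraph H₁).linearPayoff c d s + (G.withGraph H₂).linearPayoff c d s := by
  simp only [linearPayoff, expectedPayoff, G.purePayoff_withGraph_sup h, dotProduct_add,
    Pi.add_apply, mul_add, Finset.sum_add_distrib]
  ring

lemma withGraph_graph_subgame (F : Finset (Fin n)) :
    G.withGraph (G.subgame F).graph = G.subgame F := rfl

lemma subgame_univ : G.subgame Finset.univ = G := by
  cases G
  simp [subgame]

lemma linearPayoff_subgame_empty (c : Fin n → ℝ) (d : Fin n → Fin m → ℝ) (s : Assignment n m) :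
    (G.subgame ∅).linearPayoff c d s = 0 := by
  have hpure (i : Fin n) : (G.subgame ∅).purePayoff s i = 0 :=
    payoffFrom_eq_zero _ (fun j _ hij => by simp [subgame] at hij) s
  simp [linearPayoff, expectedPayoff, hpure]

/-- The edges at `v` that are added to the subgame of `F` when `v` joins `F`. -/
def addedEdges (F : Finset (Fin n)) (v : Fin n) : SimpleGraph (Fin n) :=
  (G.subgame (insert v F)).graph \ (G.subgame F).graph

lemma graph_subgame_sup_addedEdges (F : Finset (Fin n)) (v : Fin n) :
    (G.subgame F).graph ⊔ G.addedEdges F v = (G.subgame (insert v F)).graph :=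
  sup_sdiff_cancel_right fun _ _ hij =>
    ⟨hij.1, hij.2.imp Finset.mem_insert_of_mem Finset.mem_insert_of_mem⟩

lemma linearPayoff_addedEdges_localPart (F : Finset (Fin n)) (v : Fin n) (c : Fin n → ℝ)
    (d : Fin n → Fin m → ℝ) (s : Assignment n m) :
    (G.withGraph (G.addedEdges F v)).linearPayoff c d (G.localPart F v s) =
      (G.withGraph (G.addedEdges F v)).linearPayoff c d s := by
  classical
  refine linearPayoff_congr _ c d fun i j ⟨⟨hij, hmem⟩, hnot⟩ => if_pos ?_
  have hi : i ∉ F := fun hi => hnot ⟨hij, Or.inl hi⟩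
  have hj : j ∉ F := fun hj => hnot ⟨hij, Or.inr hj⟩
  rcases hmem with hiv | hjv
  · exact Or.inl ((Finset.mem_insert.1 hiv).resolve_right hi)
  · obtain rfl := (Finset.mem_insert.1 hjv).resolve_right hj
    exact Or.inr ⟨hij.symm, hi⟩

lemma linearPayoff_subgame_insert (F : Finset (Fin n)) (v : Fin n) (c : Fin n → ℝ)
    (d : Fin n → Fin m → ℝ) (s : Assignment n m) :
    (G.subgame (insert v F)).linearPayoff c d s = (G.subgame F).linearPayoff c d s +
      (G.withGraph (G.addedEdges F v)).linearPayoff c d (G.localPart F v s) := by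
  have hdisjoint : Disjoint (G.subgame F).graph (G.addedEdges F v) := disjoint_sdiff_self_right
  rw [linearPayoff_addedEdges_localPart, ← G.withGraph_graph_subgame (insert v F),
    ← graph_subgame_sup_addedEdges, G.linearPayoff_withGraph_sup hdisjoint,
    withGraph_graph_subgame]

lemma linearPayoff_subgame_union {F₁ F₂ : Finset (Fin n)} (h : Disjoint F₁ F₂)
    (hadj : ∀ i ∈ F₁, ∀ j ∈ F₂, ¬ G.graph.Adj i j) (c : Fin n → ℝ) (d : Fin n → Fin m → ℝ)
    (s : Assignment n m) :
    (G.subgame (F₁ ∪ F₂)).linearPayoff c d s =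
      (G.subgame F₁).linearPayoff c d s + (G.subgame F₂).linearPayoff c d s := by
  have hsup : (G.subgame (F₁ ∪ F₂)).graph = (G.subgame F₁).graph ⊔ (G.subgame F₂).graph := by
    ext i j
    simp only [subgame, Finset.mem_union, SimpleGraph.sup_adj]
    tauto
  have hdisjoint : Disjoint (G.subgame F₁).graph (G.subgame F₂).graph := by
    refine SimpleGraph.disjoint_left.2 fun i j ⟨hij, h₁⟩ ⟨_, h₂⟩ => ?_
    rcases h₁ with hi | hj <;> rcases h₂ with hi' | hj'
    · exact Finset.disjoint_left.1 h hi hi'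
    · exact hadj i hi j hj' hij
    · exact hadj j hj i hi' hij.symm
    · exact Finset.disjoint_left.1 h hj hj'
  rw [← G.withGraph_graph_subgame (F₁ ∪ F₂), hsup, G.linearPayoff_withGraph_sup hdisjoint]
  rfl

end PolymatrixGame

namespace OVDConstraint

variable {n m : ℕ} {G : PolymatrixGame n m} {K : OVDConstraint G} {c : Fin n → ℝ}
  {d : Fin n → Fin m → ℝ}

/-- The constraint whose number on every subgame is the linear function of the payoffs with
coefficients `c` and `d`: new edges add their share, and disjoint subgames are summed. -/
noncomputable def linear (G : PolymatrixGame n m) (c : Fin n → ℝ) (d : Fin n → Fin m → ℝ) :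
    OVDConstraint G where
  value F s := (G.subgame F).linearPayoff c d s
  emptyValue := 0
  add F v s x := x + (G.withGraph (G.addedEdges F v)).linearPayoff c d s
  merge _ _ x₁ x₂ := x₁ + x₂
  value_empty s _ := G.linearPayoff_subgame_empty c d s
  value_add F v s _ _ := G.linearPayoff_subgame_insert F v c d s
  value_merge _ _ s _ h hadj := G.linearPayoff_subgame_union h hadj c d s

lemma linear_isLinear (G : PolymatrixGame n m) (c : Fin n → ℝ) (d : Fin n → Fin m → ℝ) :
    (linear G c d).IsLinear c d :=
  fun _ _ _ => rfl

/-- Larger numbers for the parts give larger numbers for the whole. This is the property of linear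
constraints that allows the dynamic program to keep only the best of several similar entries. -/
structure IsMonotone (K : OVDConstraint G) : Prop where
  insert_le : ∀ {F v s s'}, IsProfile s → IsProfile s' → v ∉ F →
    G.localPart F v s = G.localPart F v s' → K.value F s ≤ K.value F s' →
    K.value (insert v F) s ≤ K.value (insert v F) s'
  union_le : ∀ {F₁ F₂ s s'}, IsProfile s → IsProfile s' → Disjoint F₁ F₂ →
    (∀ i ∈ F₁, ∀ j ∈ F₂, ¬ G.graph.Adj i j) → K.value F₁ s ≤ K.value F₁ s' →
    K.value F₂ s ≤ K.value F₂ s' → K.value (F₁ ∪ F₂) s ≤ K.value (F₁ ∪ F₂) s'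

lemma IsLinear.isMonotone (hK : K.IsLinear c d) : K.IsMonotone where
  insert_le {F v s s'} hs hs' _ hlocal hF := by
    rw [hK _ _ hs, hK _ _ hs'] at hF ⊢
    rw [G.linearPayoff_subgame_insert, G.linearPayoff_subgame_insert, hlocal]
    gcongr
  union_le {F₁ F₂ s s'} hs hs' h hadj h₁ h₂ := by
    rw [hK _ _ hs, hK _ _ hs'] at h₁ h₂ ⊢
    rw [G.linearPayoff_subgame_union h hadj, G.linearPayoff_subgame_union h hadj]
    gcongr

lemma IsLinear.value_univ (hK : K.IsLinear c d) {s : Assignment n m} (hs : IsProfile s) :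
    K.value Finset.univ s = G.linearPayoff c d s := by
  rw [hK _ _ hs, G.subgame_univ]

end OVDConstraint

/-! ### Tables of the dynamic program -/

namespace ConstrainedAlgorithm

open NiceTree

variable {n m : ℕ} {G : PolymatrixGame n m} {K : OVDConstraint G} {ε : ℝ} {k : ℕ}
  {t t₁ t₂ : NiceTree n} {i : Fin n} {e e' e₁ e₂ : Candidate n m} {s s' : Assignment n m}

/-- The set of all entries that are generated at the root of the tree, before only the best ones
are kept. -/
def generated (K : OVDConstraint G) (ε : ℝ) (k : ℕ) : NiceTree n → Set (Candidate n m)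
  | .start X => {e | StartStep K k X e}
  | .introduce i t => {e | ∃ e' ∈ table K ε k t, IntroduceStep k i e' e}
  | .forget i t => {e | ∃ e' ∈ table K ε k t, ForgetStep K ε i t e' e}
  | .join t₁ t₂ => {e | ∃ e₁ ∈ table K ε k t₁, ∃ e₂ ∈ table K ε k t₂, JoinStep K t₁ t₂ e₁ e₂ e}

lemma table_eq_keepBest_generated (K : OVDConstraint G) (ε : ℝ) (k : ℕ) (t : NiceTree n) :
    table K ε k t = keepBest (generated K ε k t) := by
  cases t <;> rfl

lemma mem_generated_of_mem_table (he : e ∈ table K ε k t) : e ∈ generated K ε k t := by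
  rw [table_eq_keepBest_generated] at he
  exact he.1

lemma val_le_of_mem_table (he : e ∈ table K ε k t) (he' : e' ∈ table K ε k t)
    (hstrat : e'.strat = e.strat) (hpay : e'.pay = e.pay) : e'.val ≤ e.val := by
  rw [table_eq_keepBest_generated] at he
  exact he.2 e' (mem_generated_of_mem_table he') hstrat hpay

lemma exists_mem_keepBest {D : Set (Candidate n m)} (hD : D.Finite) (he : e ∈ D) :
    ∃ e' ∈ keepBest D, e'.strat = e.strat ∧ e'.pay = e.pay ∧ e.val ≤ e'.val := by
  obtain ⟨e', ⟨he', hstrat, hpay⟩, hmax⟩ := Set.exists_max_image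
    {e' ∈ D | e'.strat = e.strat ∧ e'.pay = e.pay} Candidate.val (hD.subset fun _ h => h.1)
    ⟨e, he, rfl, rfl⟩
  exact ⟨e', ⟨he', fun b hb hbs hbp => hmax b ⟨hb, hbs.trans hstrat, hbp.trans hpay⟩⟩,
    hstrat, hpay, hmax e ⟨he, rfl, rfl⟩⟩

lemma finite_setOf_startStep (K : OVDConstraint G) (k : ℕ) (X : Finset (Fin n)) :
    {e | StartStep K k X e}.Finite := by
  have hfinite : {s : Assignment n m | ∀ i, s i ∈ {σ | IsKUniform k σ} ∪ {0}}.Finite :=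
    Set.Finite.pi' fun _ => (finite_setOf_isKUniform m k).union (Set.finite_singleton 0)
  refine (hfinite.image fun s => (⟨s, 0, K.emptyValue⟩ : Candidate n m)).subset ?_
  rintro e ⟨hstrat, hpay, hval⟩
  refine ⟨e.strat, fun i => ?_, Candidate.ext rfl hpay.symm hval.symm⟩
  have hi := hstrat i
  split_ifs at hi
  · exact Or.inl hi
  · exact Or.inr hi

lemma finite_setOf_introduceStep (k : ℕ) (i : Fin n) (e' : Candidate n m) :
    {e | IntroduceStep k i e' e}.Finite := by
  refine ((finite_setOf_isKUniform m k).image fun σ => (⟨Function.update e'.strat i σ,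
    Function.update e'.pay i 0, e'.val⟩ : Candidate n m)).subset ?_
  rintro e ⟨σ, hσ, hstrat, hpay, hval⟩
  exact ⟨σ, hσ, Candidate.ext hstrat.symm hpay.symm hval.symm⟩

lemma finite_setOf_forgetStep (K : OVDConstraint G) (ε : ℝ) (i : Fin n) (t : NiceTree n)
    (e' : Candidate n m) : {e | ForgetStep K ε i t e' e}.Finite :=
  Set.Subsingleton.finite fun _ ⟨_, hs₁, hp₁, hv₁⟩ _ ⟨_, hs₂, hp₂, hv₂⟩ =>
    Candidate.ext (hs₁.trans hs₂.symm) (hp₁.trans hp₂.symm) (hv₁.trans hv₂.symm)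

lemma finite_setOf_joinStep (K : OVDConstraint G) (t₁ t₂ : NiceTree n)
    (e₁ e₂ : Candidate n m) : {e | JoinStep K t₁ t₂ e₁ e₂ e}.Finite :=
  Set.Subsingleton.finite fun _ ⟨_, hs₁, hp₁, hv₁⟩ _ ⟨_, hs₂, hp₂, hv₂⟩ =>
    Candidate.ext (hs₁.trans hs₂.symm) (hp₁.trans hp₂.symm) (hv₁.trans hv₂.symm)

lemma finite_generated (K : OVDConstraint G) (ε : ℝ) (k : ℕ) (t : NiceTree n) :
    (generated K ε k t).Finite := by
  have htable (t : NiceTree n) (h : (generated K ε k t).Finite) : (table K ε k t).Finite :=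
    h.subset fun _ => mem_generated_of_mem_table
  induction t with
  | start X => exact finite_setOf_startStep K k X
  | introduce i t ih =>
    refine ((htable t ih).biUnion fun e' _ => finite_setOf_introduceStep k i e').subset ?_
    rintro e ⟨e', he', h⟩
    exact Set.mem_biUnion he' h
  | forget i t ih =>
    refine ((htable t ih).biUnion fun e' _ => finite_setOf_forgetStep K ε i t e').subset ?_
    rintro e ⟨e', he', h⟩
    exact Set.mem_biUnion he' h
  | join t₁ t₂ ih₁ ih₂ =>
    refine ((htable t₁ ih₁).biUnion fun e₁ _ => (htable t₂ ih₂).biUnion fun e₂ _ =>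
      finite_setOf_joinStep K t₁ t₂ e₁ e₂).subset ?_
    rintro e ⟨e₁, he₁, e₂, he₂, h⟩
    exact Set.mem_biUnion he₁ (Set.mem_biUnion he₂ h)

lemma exists_mem_table (he : e ∈ generated K ε k t) :
    ∃ e' ∈ table K ε k t, e'.strat = e.strat ∧ e'.pay = e.pay ∧ e.val ≤ e'.val := by
  rw [table_eq_keepBest_generated]
  exact exists_mem_keepBest (finite_generated K ε k t) he

lemma exists_unrolls (he : e ∈ table K ε k t) : ∃ s, Unrolls K ε k t e s := by
  induction t generalizing e with
  | start X => exact ⟨0, rfl⟩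
  | introduce i t ih =>
    obtain ⟨e', he', h⟩ := mem_generated_of_mem_table he
    obtain ⟨s, hs⟩ := ih he'
    exact ⟨s, e', he', h, hs⟩
  | forget i t ih =>
    obtain ⟨e', he', h⟩ := mem_generated_of_mem_table he
    obtain ⟨s, hs⟩ := ih he'
    exact ⟨_, e', he', h, s, hs, rfl⟩
  | join t₁ t₂ ih₁ ih₂ =>
    obtain ⟨e₁, he₁, e₂, he₂, h⟩ := mem_generated_of_mem_table he
    obtain ⟨s₁, hs₁⟩ := ih₁ he₁
    obtain ⟨s₂, hs₂⟩ := ih₂ he₂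
    exact ⟨_, e₁, he₁, e₂, he₂, h, s₁, s₂, hs₁, hs₂, rfl⟩

lemma strat_eq_zero_and_pay_eq_zero (ht : t.WellFormed) (he : e ∈ table K ε k t) {j : Fin n}
    (hj : j ∉ t.bag) : e.strat j = 0 ∧ e.pay j = 0 := by
  induction t generalizing e with
  | start X =>
    obtain ⟨hstrat, hpay, -⟩ := mem_generated_of_mem_table he
    exact ⟨(if_neg hj).mp (hstrat j), by rw [hpay, Pi.zero_apply]⟩
  | introduce i t ih =>
    obtain ⟨e', he', σ, -, hstrat, hpay, -⟩ := mem_generated_of_mem_table he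
    obtain ⟨hji, hjt⟩ := not_or.1 (Finset.mem_insert.not.1 hj)
    rw [hstrat, hpay, Function.update_of_ne hji, Function.update_of_ne hji]
    exact ih ht.2 he' hjt
  | forget i t ih =>
    obtain ⟨e', he', -, hstrat, hpay, -⟩ := mem_generated_of_mem_table he
    refine ⟨?_, by rw [hpay]; exact funext fun l => if_neg hj⟩
    rw [hstrat]
    by_cases hji : j = i
    · rw [hji, Function.update_self]
    · rw [Function.update_of_ne hji]
      exact (ih ht.2 he' fun h => hj (Finset.mem_erase.2 ⟨hji, h⟩)).1
  | join t₁ t₂ ih₁ ih₂ =>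
    obtain ⟨e₁, he₁, e₂, he₂, -, hstrat, hpay, -⟩ := mem_generated_of_mem_table he
    obtain ⟨hs₁, hp₁⟩ := ih₁ ht.2.1 he₁ hj
    obtain ⟨-, hp₂⟩ := ih₂ ht.2.2 he₂ (ht.1 ▸ hj)
    exact ⟨hstrat ▸ hs₁, by rw [hpay, Pi.add_apply, hp₁, hp₂, add_zero]⟩

/-- The entry `e` of the root of `t` describes the profile `s`: the strategies in the bag are those
of `s`, and the payoffs obtained from the forgotten players are correct up to half a rounding unit
`ε / (2 n)` for every forgotten player. -/
structure Tracks (G : PolymatrixGame n m) (ε : ℝ) (t : NiceTree n) (e : Candidate n m)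
    (s : Assignment n m) : Prop where
  strat_eq : ∀ j ∈ t.bag, e.strat j = s j
  abs_pay_sub_le : ∀ j ∈ t.bag, ∀ l,
    |e.pay j l - G.payoffFrom t.forgotten s j l| ≤ t.forgotten.card * (ε / (4 * n))

lemma StartStep.tracks {X : Finset (Fin n)} (h : StartStep K k X e)
    (hstrat : ∀ j ∈ X, e.strat j = s j) : Tracks G ε (.start X) e s where
  strat_eq := hstrat
  abs_pay_sub_le j _ l := by
    rw [forgotten_start, h.2.1, G.payoffFrom_eq_zero (by simp)]
    simp

lemma IntroduceStep.tracks (h : IntroduceStep k i e' e) (hε : 0 < ε)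
    (ht : (introduce i t).IsPartialDecomposition G.graph) (he' : Tracks G ε t e' s)
    (hi : e.strat i = s i) : Tracks G ε (.introduce i t) e s := by
  obtain ⟨σ, -, hstrat, hpay, -⟩ := h
  refine ⟨fun j hj => ?_, fun j hj l => ?_⟩
  · by_cases hji : j = i
    · rw [hji, hi]
    · rw [hstrat, Function.update_of_ne hji]
      exact he'.strat_eq j ((Finset.mem_insert.1 hj).resolve_left hji)
  · rw [forgotten_introduce ht.notMem_players_of_introduce, hpay]
    by_cases hji : j = i
    · rw [hji, Function.update_self, G.payoffFrom_eq_zero fun _ => ht.not_adj_of_introduce,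
        sub_self, abs_zero]
      positivity
    · rw [Function.update_of_ne hji]
      exact he'.abs_pay_sub_le j ((Finset.mem_insert.1 hj).resolve_left hji) l

lemma ForgetStep.tracks (h : ForgetStep K ε i t e' e) (hε : 0 < ε)
    (ht : (forget i t).WellFormed) (he' : Tracks G ε t e' s) :
    Tracks G ε (.forget i t) e s := by
  obtain ⟨-, hstrat, hpay, -⟩ := h
  have hn : (0 : ℝ) < n := by exact_mod_cast i.pos
  refine ⟨fun j hj => ?_, fun j hj l => ?_⟩
  · obtain ⟨hji, hjt⟩ := Finset.mem_erase.1 hj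
    rw [hstrat, Function.update_of_ne hji, he'.strat_eq j hjt]
  · have hi : G.payoffFrom {i} e'.strat j = G.payoffFrom {i} s j :=
      G.payoffFrom_congr fun v hv _ => by rw [Finset.mem_singleton.1 hv, he'.strat_eq i ht.1]
    have hround := abs_roundTo_sub_le (show 0 < ε / (2 * n) by positivity)
      (e'.pay j l + G.payoffFrom {i} s j l)
    rw [forgotten_forget ht, G.payoffFrom_insert (notMem_forgotten ht.1),
      Finset.card_insert_of_notMem (notMem_forgotten ht.1), hpay]
    dsimp only
    rw [if_pos (show j ∈ t.bag.erase i from hj), hi, Pi.add_apply]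
    calc |roundTo (ε / (2 * n)) (e'.pay j l + G.payoffFrom {i} s j l) -
            (G.payoffFrom t.forgotten s j l + G.payoffFrom {i} s j l)|
        ≤ _ := abs_sub_le _ (e'.pay j l + G.payoffFrom {i} s j l) _
      _ ≤ ε / (2 * n) / 2 + t.forgotten.card * (ε / (4 * n)) := by
          rw [add_sub_add_right_eq_sub]
          exact add_le_add hround (he'.abs_pay_sub_le j (Finset.mem_of_mem_erase hj) l)
      _ = (t.forgotten.card + 1 : ℕ) * (ε / (4 * n)) := by
          push_cast
          field_simp
          ring

lemma JoinStep.tracks (h : JoinStep K t₁ t₂ e₁ e₂ e)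
    (ht : (join t₁ t₂).IsPartialDecomposition G.graph) (he₁ : Tracks G ε t₁ e₁ s)
    (he₂ : Tracks G ε t₂ e₂ s) : Tracks G ε (.join t₁ t₂) e s := by
  obtain ⟨-, hstrat, hpay, -⟩ := h
  refine ⟨fun j hj => hstrat ▸ he₁.strat_eq j hj, fun j hj l => ?_⟩
  rw [forgotten_join ht.wellFormed.1, G.payoffFrom_union ht.disjoint_forgotten,
    Finset.card_union_of_disjoint ht.disjoint_forgotten, hpay]
  simp only [Pi.add_apply, add_sub_add_comm, Nat.cast_add, add_mul]
  exact (abs_add_le _ _).trans (add_le_add (he₁.abs_pay_sub_le j hj l)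
    (he₂.abs_pay_sub_le j (ht.wellFormed.1 ▸ hj : j ∈ t₂.bag) l))

lemma Tracks.abs_heldPayoff_sub_le (he : Tracks G ε t e s) (hε : 0 < ε)
    (ht : (forget i t).IsPartialDecomposition G.graph) (l : Fin m) :
    |heldPayoff G (t.bag.erase i) e i l - G.purePayoff s i l| ≤ ε / 4 := by
  have hn : (0 : ℝ) < n := by exact_mod_cast i.pos
  have hpure : G.purePayoff s i =
      G.payoffFrom t.forgotten s i + G.payoffFrom (t.bag.erase i) s i := by
    rw [← G.payoffFrom_union (t.disjoint_forgotten_bag.mono_right (Finset.erase_subset _ _))]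
    refine G.purePayoff_eq_payoffFrom (fun j hij => Finset.mem_union.2 ?_) s
    exact (ht.mem_forgotten_or_mem_bag_of_adj hij).imp_right fun hj =>
      Finset.mem_erase.2 ⟨hij.ne', hj⟩
  have hbag : G.payoffFrom (t.bag.erase i) e.strat i = G.payoffFrom (t.bag.erase i) s i :=
    G.payoffFrom_congr fun j hj _ => he.strat_eq j (Finset.mem_of_mem_erase hj)
  have hcard : (t.forgotten.card : ℝ) ≤ n := by
    exact_mod_cast t.forgotten.card_le_univ.trans_eq (Fintype.card_fin n)
  rw [heldPayoff, hpure, hbag, Pi.add_apply, Pi.add_apply, add_sub_add_right_eq_sub]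
  calc |e.pay i l - G.payoffFrom t.forgotten s i l|
      ≤ t.forgotten.card * (ε / (4 * n)) := he.abs_pay_sub_le i ht.wellFormed.1 l
    _ ≤ n * (ε / (4 * n)) := by gcongr
    _ = ε / 4 := by field_simp

lemma Tracks.regret_le_of_isHappy (he : Tracks G ε t e s) (hε : 0 < ε)
    (ht : (forget i t).IsPartialDecomposition G.graph) (hs : s i ∈ stdSimplex ℝ (Fin m))
    (hhappy : IsHappy G ε (t.bag.erase i) e i) (l : Fin m) :
    G.purePayoff s i l - 3 / 2 * ε ≤ G.expectedPayoff s i := by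
  rw [IsHappy, he.strat_eq i ht.wellFormed.1] at hhappy
  have h := sub_le_dotProduct_of_abs_sub_le hs (he.abs_heldPayoff_sub_le hε ht) hhappy l
  rwa [show ε + 2 * (ε / 4) = 3 / 2 * ε by ring] at h

lemma Tracks.isHappy_of_regret_le (he : Tracks G ε t e s) (hε : 0 < ε)
    (ht : (forget i t).IsPartialDecomposition G.graph) (hs : s i ∈ stdSimplex ℝ (Fin m))
    (hregret : ∀ l, G.purePayoff s i l - ε / 2 ≤ G.expectedPayoff s i) :
    IsHappy G ε (t.bag.erase i) e i := by
  intro l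
  rw [he.strat_eq i ht.wellFormed.1]
  have h := sub_le_dotProduct_of_abs_sub_le hs
    (fun l => (abs_sub_comm _ _).trans_le (he.abs_heldPayoff_sub_le hε ht l)) hregret l
  rwa [show ε / 2 + 2 * (ε / 4) = ε by ring] at h

lemma localPart_forgotten_congr (ht : (forget i t).IsPartialDecomposition G.graph)
    (h : ∀ j ∈ t.bag, s j = s' j) :
    G.localPart t.forgotten i s = G.localPart t.forgotten i s' := by
  classical
  funext j
  unfold PolymatrixGame.localPart
  refine ite_congr rfl (fun hj => h j ?_) fun _ => rfl
  rcases hj with rfl | ⟨hij, hj⟩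
  · exact ht.wellFormed.1
  · exact (ht.mem_forgotten_or_mem_bag_of_adj hij).resolve_left hj

lemma ForgetStep.val_eq (h : ForgetStep K ε i t e' e)
    (ht : (forget i t).IsPartialDecomposition G.graph) (hs : IsProfile s)
    (hstrat : ∀ j ∈ t.bag, e'.strat j = s j) (hval : e'.val = K.value t.forgotten s) :
    e.val = K.value (forget i t).forgotten s := by
  rw [h.2.2.2, localPart_forgotten_congr ht hstrat, hval, forgotten_forget ht.wellFormed,
    K.value_add _ _ s hs (notMem_forgotten ht.wellFormed.1)]

lemma JoinStep.val_eq (h : JoinStep K t₁ t₂ e₁ e₂ e)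
    (ht : (join t₁ t₂).IsPartialDecomposition G.graph) (hs : IsProfile s)
    (hval₁ : e₁.val = K.value t₁.forgotten s) (hval₂ : e₂.val = K.value t₂.forgotten s) :
    e.val = K.value (join t₁ t₂).forgotten s := by
  rw [h.2.2.2, hval₁, hval₂, forgotten_join ht.wellFormed.1,
    K.value_merge _ _ s hs ht.disjoint_forgotten fun _ hu _ => ht.not_adj_of_join hu]

end ConstrainedAlgorithm

/-! ### Profiles returned by the algorithm -/

namespace ConstrainedAlgorithm

open NiceTree

variable {n m : ℕ} {G : PolymatrixGame n m} {K : OVDConstraint G} {ε : ℝ} {k : ℕ}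
  {t t₁ t₂ : NiceTree n} {i : Fin n} {e : Candidate n m} {s s' : Assignment n m}

/-- The entry `e` of the table at the root of `t` lists the strategies that the players of the bag
have in `s`, and can be unrolled to those that the forgotten players have in `s`. -/
structure Realizes (K : OVDConstraint G) (ε : ℝ) (k : ℕ) (t : NiceTree n) (e : Candidate n m)
    (s : Assignment n m) : Prop where
  mem_table : e ∈ table K ε k t
  strat_eq : ∀ j ∈ t.bag, e.strat j = s j
  exists_unrolls : ∃ s₀, Unrolls K ε k t e s₀ ∧ ∀ j ∈ t.forgotten, s₀ j = s j

namespace Realizes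

lemma congr (h : Realizes K ε k t e s) (ht : t.WellFormed) (hs : ∀ j ∈ t.players, s j = s' j) :
    Realizes K ε k t e s' := by
  obtain ⟨he, hstrat, s₀, hunroll, hs₀⟩ := h
  exact ⟨he, fun j hj => (hstrat j hj).trans (hs j (ht.bag_subset_players hj)), s₀, hunroll,
    fun j hj => (hs₀ j hj).trans (hs j (Finset.sdiff_subset hj))⟩

lemma startStep {X : Finset (Fin n)} (h : Realizes K ε k (start X) e s) : StartStep K k X e :=
  mem_generated_of_mem_table h.mem_table

lemma exists_introduceStep (h : Realizes K ε k (introduce i t) e s)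
    (ht : (introduce i t).IsPartialDecomposition G.graph) :
    ∃ e', Realizes K ε k t e' s ∧ IntroduceStep k i e' e := by
  obtain ⟨-, hstrat, s₀, ⟨e', he', hstep, hunroll⟩, hs₀⟩ := h
  rw [forgotten_introduce ht.notMem_players_of_introduce] at hs₀
  refine ⟨e', ⟨he', fun j hj => ?_, s₀, hunroll, hs₀⟩, hstep⟩
  obtain ⟨σ, -, he, -⟩ := hstep
  rw [← hstrat j (Finset.mem_insert_of_mem hj), he,
    Function.update_of_ne (ne_of_mem_of_not_mem hj ht.wellFormed.1)]

lemma exists_forgetStep (h : Realizes K ε k (forget i t) e s) (ht : (forget i t).WellFormed) :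
    ∃ e', Realizes K ε k t e' s ∧ ForgetStep K ε i t e' e := by
  obtain ⟨-, hstrat, _, ⟨e', he', hstep, s₀, hunroll, rfl⟩, hs₀⟩ := h
  rw [forgotten_forget ht] at hs₀
  refine ⟨e', ⟨he', fun j hj => ?_, s₀, hunroll, fun j hj => ?_⟩, hstep⟩
  · by_cases hji : j = i
    · rw [hji, ← hs₀ i (Finset.mem_insert_self i _), Function.update_self]
    · rw [← hstrat j (Finset.mem_erase.2 ⟨hji, hj⟩), hstep.2.1, Function.update_of_ne hji]
  · rw [← hs₀ j (Finset.mem_insert_of_mem hj),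
      Function.update_of_ne (ne_of_mem_of_not_mem hj (notMem_forgotten ht.1))]

lemma exists_joinStep (h : Realizes K ε k (join t₁ t₂) e s)
    (ht : (join t₁ t₂).IsPartialDecomposition G.graph) :
    ∃ e₁ e₂, Realizes K ε k t₁ e₁ s ∧ Realizes K ε k t₂ e₂ s ∧ JoinStep K t₁ t₂ e₁ e₂ e := by
  obtain ⟨-, hstrat, _, ⟨e₁, he₁, e₂, he₂, hstep, s₁, s₂, hunroll₁, hunroll₂, rfl⟩, hs₀⟩ := h
  rw [forgotten_join ht.wellFormed.1] at hs₀
  have hstrat₁ (j : Fin n) (hj : j ∈ t₁.bag) : e₁.strat j = s j := by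
    rw [← hstrat j hj, hstep.2.1]
  refine ⟨e₁, e₂, ⟨he₁, hstrat₁, s₁, hunroll₁, fun j hj => ?_⟩,
    ⟨he₂, fun j hj => ?_, s₂, hunroll₂, fun j hj => ?_⟩, hstep⟩
  · exact (if_pos hj).symm.trans (hs₀ j (Finset.mem_union_left _ hj))
  · rw [← hstep.1, hstrat₁ j (ht.wellFormed.1 ▸ hj)]
  · exact (if_neg (Finset.disjoint_right.1 ht.disjoint_forgotten hj)).symm.trans
      (hs₀ j (Finset.mem_union_right _ hj))

lemma isKUniform (h : Realizes K ε k t e s) (ht : t.IsPartialDecomposition G.graph) {j : Fin n}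
    (hj : j ∈ t.players) : IsKUniform k (s j) := by
  induction t generalizing e with
  | start X =>
    rw [← h.strat_eq j hj]
    exact (if_pos hj).mp (h.startStep.1 j)
  | introduce i t ih =>
    obtain ⟨e', he', σ, hσ, hstrat, -⟩ := h.exists_introduceStep ht
    rcases Finset.mem_insert.1 hj with rfl | hj
    · rwa [← h.strat_eq j (Finset.mem_insert_self j _), hstrat, Function.update_self]
    · exact ih he' ht.of_introduce hj
  | forget i t ih =>
    obtain ⟨e', he', -⟩ := h.exists_forgetStep ht.wellFormed
    exact ih he' ht.of_forget hj
  | join t₁ t₂ ih₁ ih₂ =>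
    obtain ⟨e₁, e₂, he₁, he₂, -⟩ := h.exists_joinStep ht
    exact (Finset.mem_union.1 hj).elim (ih₁ he₁ ht.of_join_left) (ih₂ he₂ ht.of_join_right)

lemma tracks (h : Realizes K ε k t e s) (hε : 0 < ε) (ht : t.IsPartialDecomposition G.graph) :
    Tracks G ε t e s := by
  induction t generalizing e with
  | start X => exact h.startStep.tracks h.strat_eq
  | introduce i t ih =>
    obtain ⟨e', he', hstep⟩ := h.exists_introduceStep ht
    exact hstep.tracks hε ht (ih he' ht.of_introduce) (h.strat_eq i (Finset.mem_insert_self i _))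
  | forget i t ih =>
    obtain ⟨e', he', hstep⟩ := h.exists_forgetStep ht.wellFormed
    exact hstep.tracks hε ht.wellFormed (ih he' ht.of_forget)
  | join t₁ t₂ ih₁ ih₂ =>
    obtain ⟨e₁, e₂, he₁, he₂, hstep⟩ := h.exists_joinStep ht
    exact hstep.tracks ht (ih₁ he₁ ht.of_join_left) (ih₂ he₂ ht.of_join_right)

lemma val_eq (h : Realizes K ε k t e s) (ht : t.IsPartialDecomposition G.graph)
    (hs : IsProfile s) : e.val = K.value t.forgotten s := by
  induction t generalizing e with
  | start X => rw [h.startStep.2.2, forgotten_start, K.value_empty s hs]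
  | introduce i t ih =>
    obtain ⟨e', he', σ, -, -, -, hval⟩ := h.exists_introduceStep ht
    rw [hval, ih he' ht.of_introduce, forgotten_introduce ht.notMem_players_of_introduce]
  | forget i t ih =>
    obtain ⟨e', he', hstep⟩ := h.exists_forgetStep ht.wellFormed
    exact hstep.val_eq ht hs he'.strat_eq (ih he' ht.of_forget)
  | join t₁ t₂ ih₁ ih₂ =>
    obtain ⟨e₁, e₂, he₁, he₂, hstep⟩ := h.exists_joinStep ht
    exact hstep.val_eq ht hs (ih₁ he₁ ht.of_join_left) (ih₂ he₂ ht.of_join_right)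

lemma regret_le (h : Realizes K ε k t e s) (hε : 0 < ε) (ht : t.IsPartialDecomposition G.graph)
    (hs : IsProfile s) {j : Fin n} (hj : j ∈ t.forgotten) (l : Fin m) :
    G.purePayoff s j l - 3 / 2 * ε ≤ G.expectedPayoff s j := by
  induction t generalizing e with
  | start X => simp [forgotten_start] at hj
  | introduce i t ih =>
    obtain ⟨e', he', -⟩ := h.exists_introduceStep ht
    exact ih he' ht.of_introduce (forgotten_introduce ht.notMem_players_of_introduce ▸ hj)
  | forget i t ih =>
    obtain ⟨e', he', hhappy, -⟩ := h.exists_forgetStep ht.wellFormed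
    rw [forgotten_forget ht.wellFormed] at hj
    rcases Finset.mem_insert.1 hj with rfl | hj
    · exact (he'.tracks hε ht.of_forget).regret_le_of_isHappy hε ht (hs j) hhappy l
    · exact ih he' ht.of_forget hj
  | join t₁ t₂ ih₁ ih₂ =>
    obtain ⟨e₁, e₂, he₁, he₂, -⟩ := h.exists_joinStep ht
    rw [forgotten_join ht.wellFormed.1] at hj
    exact (Finset.mem_union.1 hj).elim (ih₁ he₁ ht.of_join_left) (ih₂ he₂ ht.of_join_right)

end Realizes

open Classical in
lemma exists_realizes (hk : 0 < k) (ht : t.IsPartialDecomposition G.graph)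
    (he : e ∈ table K ε k t) (hs : IsProfile s) (hstrat : ∀ j ∈ t.bag, e.strat j = s j) :
    ∃ s₁, IsProfile s₁ ∧ (∀ j ∉ t.forgotten, s₁ j = s j) ∧ Realizes K ε k t e s₁ := by
  obtain ⟨s₀, hunroll⟩ := exists_unrolls he
  have hrealizes : Realizes K ε k t e (t.forgotten.piecewise s₀ s) :=
    ⟨he, fun j hj => (hstrat j hj).trans
      (Finset.piecewise_eq_of_notMem _ _ _ (notMem_forgotten hj)).symm,
      s₀, hunroll, fun j hj => (Finset.piecewise_eq_of_mem _ _ _ hj).symm⟩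
  refine ⟨_, fun j => ?_, fun j hj => Finset.piecewise_eq_of_notMem _ _ _ hj, hrealizes⟩
  by_cases hj : j ∈ t.forgotten
  · exact (hrealizes.isKUniform ht (Finset.sdiff_subset hj)).mem_stdSimplex hk
  · rw [Finset.piecewise_eq_of_notMem _ _ _ hj]
    exact hs j

/-- Some entry of `D` at the root of `t` describes `s` with at least the value that the constraint
assigns to `s`.  This is the induction hypothesis for the completeness of the algorithm: the
strategies of `s` themselves may have been discarded in favour of an entry of higher value. -/
def Covers (K : OVDConstraint G) (ε : ℝ) (t : NiceTree n) (D : Set (Candidate n m))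
    (s : Assignment n m) : Prop :=
  ∃ e ∈ D, Tracks G ε t e s ∧ K.value t.forgotten s ≤ e.val

lemma Covers.of_generated (h : Covers K ε t (generated K ε k t) s) :
    Covers K ε t (table K ε k t) s := by
  obtain ⟨e, he, htracks, hval⟩ := h
  obtain ⟨e', he', hstrat, hpay, hle⟩ := exists_mem_table he
  exact ⟨e', he', ⟨hstrat ▸ htracks.1, hpay ▸ htracks.2⟩, hval.trans hle⟩

open Classical in
lemma covers_start (X : Finset (Fin n)) (hs : IsProfile s) (hsk : ∀ j, IsKUniform k (s j)) :
    Covers K ε (start X) (generated K ε k (start X)) s := by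
  have hstep : StartStep K k X ⟨fun j => if j ∈ X then s j else 0, 0, K.emptyValue⟩ := by
    refine ⟨fun j => ?_, rfl, rfl⟩
    dsimp only
    split_ifs
    exacts [hsk j, rfl]
  refine ⟨_, hstep, hstep.tracks fun j hj => if_pos hj, ?_⟩
  rw [forgotten_start, K.value_empty s hs]

lemma Covers.introduce (h : Covers K ε t (table K ε k t) s) (hε : 0 < ε)
    (ht : (introduce i t).IsPartialDecomposition G.graph) (hi : IsKUniform k (s i)) :
    Covers K ε (introduce i t) (generated K ε k (introduce i t)) s := by
  obtain ⟨e', he', htracks, hval⟩ := h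
  have hstep : IntroduceStep k i e'
      ⟨Function.update e'.strat i (s i), Function.update e'.pay i 0, e'.val⟩ :=
    ⟨s i, hi, rfl, rfl, rfl⟩
  refine ⟨_, ⟨e', he', hstep⟩, hstep.tracks hε ht htracks (Function.update_self i _ _), ?_⟩
  rwa [forgotten_introduce ht.notMem_players_of_introduce]

lemma Covers.forget (h : Covers K ε t (table K ε k t) s) (hε : 0 < ε)
    (hk : 0 < k) (ht : (forget i t).IsPartialDecomposition G.graph) (hK : K.IsMonotone)
    (hs : G.IsApproxNE (ε / 2) s) :
    Covers K ε (forget i t) (generated K ε k (forget i t)) s := by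
  obtain ⟨e', he', htracks, hval⟩ := h
  obtain ⟨e, hstep⟩ : ∃ e, ForgetStep K ε i t e' e :=
    ⟨⟨_, _, _⟩, htracks.isHappy_of_regret_le hε ht (hs.1 i) (hs.2 i), rfl, rfl, rfl⟩
  refine ⟨e, ⟨e', he', hstep⟩, hstep.tracks hε ht.wellFormed htracks, ?_⟩
  obtain ⟨s₁, hs₁, hs₁s, hrealizes⟩ := exists_realizes hk ht.of_forget he' hs.1 htracks.strat_eq
  have hval₁ := hrealizes.val_eq ht.of_forget hs₁
  rw [hstep.val_eq ht hs₁ hrealizes.strat_eq hval₁, forgotten_forget ht.wellFormed]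
  exact hK.insert_le hs.1 hs₁ (notMem_forgotten ht.wellFormed.1)
    (localPart_forgotten_congr ht fun j hj => (hs₁s j (notMem_forgotten hj)).symm)
    (hval.trans_eq hval₁)

lemma Covers.join (h₁ : Covers K ε t₁ (table K ε k t₁) s)
    (h₂ : Covers K ε t₂ (table K ε k t₂) s) (hk : 0 < k)
    (ht : (join t₁ t₂).IsPartialDecomposition G.graph) (hK : K.IsMonotone) (hs : IsProfile s) :
    Covers K ε (join t₁ t₂) (generated K ε k (join t₁ t₂)) s := by
  obtain ⟨e₁, he₁, htracks₁, hval₁⟩ := h₁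
  obtain ⟨e₂, he₂, htracks₂, hval₂⟩ := h₂
  obtain ⟨hbag, hwf₁, hwf₂⟩ := ht.wellFormed
  have hstrat : e₁.strat = e₂.strat := by
    funext j
    by_cases hj : j ∈ t₁.bag
    · rw [htracks₁.strat_eq j hj, htracks₂.strat_eq j (hbag ▸ hj)]
    · rw [(strat_eq_zero_and_pay_eq_zero hwf₁ he₁ hj).1,
        (strat_eq_zero_and_pay_eq_zero hwf₂ he₂ (hbag ▸ hj)).1]
  obtain ⟨e, hstep⟩ : ∃ e, JoinStep K t₁ t₂ e₁ e₂ e :=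
    ⟨⟨e₁.strat, e₁.pay + e₂.pay, _⟩, hstrat, rfl, rfl, rfl⟩
  refine ⟨e, ⟨e₁, he₁, e₂, he₂, hstep⟩, hstep.tracks ht htracks₁ htracks₂, ?_⟩
  obtain ⟨s₁, hs₁, hs₁s, hrealizes⟩ := exists_realizes hk ht.of_join_left he₁ hs htracks₁.strat_eq
  obtain ⟨s₂, hs₂, hs₂s₁, hrealizes₂⟩ := exists_realizes hk ht.of_join_right he₂ hs₁
    fun j hj => by rw [htracks₂.strat_eq j hj, hs₁s j (notMem_forgotten (hbag ▸ hj))]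
  have hrealizes₁ : Realizes K ε k t₁ e₁ s₂ := hrealizes.congr hwf₁ fun j hj =>
    (hs₂s₁ j (Finset.disjoint_left.1 ht.disjoint_players_forgotten hj)).symm
  have hval₁' := hrealizes₁.val_eq ht.of_join_left hs₂
  have hval₂' := hrealizes₂.val_eq ht.of_join_right hs₂
  rw [hstep.val_eq ht hs₂ hval₁' hval₂', forgotten_join hbag]
  exact hK.union_le hs hs₂ ht.disjoint_forgotten (fun _ hu _ => ht.not_adj_of_join hu)
    (hval₁.trans_eq hval₁') (hval₂.trans_eq hval₂')

lemma covers_of_isApproxNE (hε : 0 < ε) (hk : 0 < k) (ht : t.IsPartialDecomposition G.graph)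
    (hK : K.IsMonotone) (hs : G.IsApproxNE (ε / 2) s) (hsk : ∀ j, IsKUniform k (s j)) :
    Covers K ε t (table K ε k t) s := by
  induction t with
  | start X => exact (covers_start X hs.1 hsk).of_generated
  | introduce i t ih => exact ((ih ht.of_introduce).introduce hε ht (hsk i)).of_generated
  | forget i t ih => exact ((ih ht.of_forget).forget hε hk ht hK hs).of_generated
  | join t₁ t₂ ih₁ ih₂ =>
    exact ((ih₁ ht.of_join_left).join (ih₂ ht.of_join_right) hk ht hK hs.1).of_generated

lemma exists_returns (hε : 0 < ε) (hk : 0 < k) (ht : t.IsPartialDecomposition G.graph)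
    (hK : K.IsMonotone) (hs : G.IsApproxNE (ε / 2) s) (hsk : ∀ j, IsKUniform k (s j)) :
    ∃ s', Returns K ε k t s' := by
  obtain ⟨e, he, -⟩ := covers_of_isApproxNE hε hk ht hK hs hsk
  exact (exists_unrolls he).imp fun _ hunroll => ⟨e, he, hunroll⟩

section Returns

variable (ht : t.IsNiceTreeDecomposition G.graph) (hbag : t.bag = ∅) (hε : 0 < ε) (hk : 0 < k)

include hbag

lemma Returns.exists_realizes (h : Returns K ε k t s) : ∃ e, Realizes K ε k t e s := by
  obtain ⟨e, he, hunroll⟩ := h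
  exact ⟨e, he, by simp [hbag], s, hunroll, fun _ _ => rfl⟩

include ht

lemma Returns.isKUniform (h : Returns K ε k t s) (j : Fin n) : IsKUniform k (s j) := by
  obtain ⟨e, hrealizes⟩ := h.exists_realizes hbag
  refine hrealizes.isKUniform ht.isPartialDecomposition (Finset.sdiff_subset (t := t.bag) ?_)
  exact (ht.forgotten_eq_univ hbag).ge (Finset.mem_univ j)

include hk

lemma Returns.isProfile (h : Returns K ε k t s) : IsProfile s :=
  fun j => (h.isKUniform ht hbag j).mem_stdSimplex hk

include hε

lemma Returns.isApproxNE (h : Returns K ε k t s) : G.IsApproxNE (3 / 2 * ε) s := by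
  obtain ⟨e, hrealizes⟩ := h.exists_realizes hbag
  refine ⟨h.isProfile ht hbag hk, fun j => ?_⟩
  exact hrealizes.regret_le hε ht.isPartialDecomposition (h.isProfile ht hbag hk)
    ((ht.forgotten_eq_univ hbag).ge (Finset.mem_univ j))

lemma value_le_of_returns (hK : K.IsMonotone) (hs : G.IsApproxNE (ε / 2) s)
    (hsk : ∀ j, IsKUniform k (s j)) (h : Returns K ε k t s') :
    K.value Finset.univ s ≤ K.value Finset.univ s' := by
  obtain ⟨e, he, -, hval⟩ := covers_of_isApproxNE hε hk ht.isPartialDecomposition hK hs hsk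
  obtain ⟨e', hrealizes⟩ := h.exists_realizes hbag
  have hzero {e : Candidate n m} (he : e ∈ table K ε k t) (j : Fin n) :
      e.strat j = 0 ∧ e.pay j = 0 :=
    strat_eq_zero_and_pay_eq_zero ht.wellFormed he (by simp [hbag])
  have hle : e.val ≤ e'.val := val_le_of_mem_table hrealizes.mem_table he
    (funext fun j => (hzero he j).1.trans (hzero hrealizes.mem_table j).1.symm)
    (funext fun j => (hzero he j).2.trans (hzero hrealizes.mem_table j).2.symm)
  rw [← ht.forgotten_eq_univ hbag]
  calc K.value t.forgotten s ≤ e.val := hval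
    _ ≤ e'.val := hle
    _ = K.value t.forgotten s' :=
        hrealizes.val_eq ht.isPartialDecomposition (h.isProfile ht hbag hk)

end Returns

end ConstrainedAlgorithm

/-! ### Sampling from a profile -/

section Sampling

open MeasureTheory ProbabilityTheory
open scoped NNReal

lemma measureReal_le_abs_sum_le_of_iIndepFun {Ω ι : Type*} [MeasurableSpace Ω] {μ : Measure Ω}
    [IsFiniteMeasure μ] {Y : ι → Ω → ℝ} (hindep : iIndepFun Y μ) {c : ι → ℝ≥0} {S : Finset ι}
    (hsub : ∀ i ∈ S, HasSubgaussianMGF (Y i) (c i) μ) {η : ℝ} (hη : 0 ≤ η) :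
    μ.real {ω | η ≤ |∑ i ∈ S, Y i ω|} ≤ 2 * Real.exp (-η ^ 2 / (2 * ∑ i ∈ S, c i)) := by
  have hindep_neg : iIndepFun (fun i => -Y i) μ :=
    hindep.comp (fun _ x => -x) fun _ => measurable_neg
  have hupper := HasSubgaussianMGF.measure_sum_ge_le_of_iIndepFun hindep hsub hη
  have hlower := HasSubgaussianMGF.measure_sum_ge_le_of_iIndepFun hindep_neg
    (fun i hi => (hsub i hi).neg) hη
  have hsubset : {ω | η ≤ |∑ i ∈ S, Y i ω|} ⊆
      {ω | η ≤ ∑ i ∈ S, Y i ω} ∪ {ω | η ≤ ∑ i ∈ S, (-Y i) ω} := fun ω hω => by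
    simpa only [Set.mem_union, Set.mem_ofPred_eq, Pi.neg_apply, Finset.sum_neg_distrib, le_abs]
      using hω
  rw [two_mul]
  exact (measureReal_mono hsubset).trans
    ((measureReal_union_le _ _).trans (add_le_add hupper hlower))

variable {X : Type*} [MeasurableSpace X] (ν : Measure X) [IsProbabilityMeasure ν]

lemma measureReal_le_abs_mean_sub_integral_le {f : X → ℝ} (hf : Measurable f) {a b : ℝ}
    (hab : ∀ x, f x ∈ Set.Icc a b) {k : ℕ} (hk : 0 < k) {δ : ℝ} (hδ : 0 ≤ δ) :
    (Measure.pi fun _ : Fin k => ν).real {ω | δ ≤ |(∑ t, f (ω t)) / k - ∫ x, f x ∂ν|} ≤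
      2 * Real.exp (-(2 * k * δ ^ 2) / (b - a) ^ 2) := by
  have hk₀ : (0 : ℝ) < k := by exact_mod_cast hk
  let Y (t : Fin k) (ω : Fin k → X) : ℝ := f (ω t) - ∫ x, f x ∂ν
  have hindep : iIndepFun Y (Measure.pi fun _ => ν) :=
    iIndepFun_pi (X := fun _ x => f x - ∫ x, f x ∂ν) fun _ => (hf.sub_const _).aemeasurable
  have hsub (t : Fin k) :
      HasSubgaussianMGF (Y t) ((‖b - a‖₊ / 2) ^ 2) (Measure.pi fun _ => ν) := by
    have h := hasSubgaussianMGF_of_mem_Icc (μ := Measure.pi fun _ => ν) (X := fun ω => f (ω t))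
      (hf.comp (measurable_pi_apply t)).aemeasurable (Filter.Eventually.of_forall fun ω => hab _)
    rwa [integral_comp_eval (μ := fun _ : Fin k => ν) (i := t) hf.aestronglyMeasurable] at h
  have hsum (ω : Fin k → X) : |∑ t, Y t ω| = k * |(∑ t, f (ω t)) / k - ∫ x, f x ∂ν| := by
    rw [← abs_of_pos hk₀, ← abs_mul, abs_of_pos hk₀, mul_sub, mul_div_cancel₀ _ hk₀.ne',
      Finset.sum_sub_distrib, Finset.sum_const, Finset.card_univ, Fintype.card_fin, nsmul_eq_mul]
  have h := measureReal_le_abs_sum_le_of_iIndepFun hindep (S := Finset.univ)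
    (fun t _ => hsub t) (mul_nonneg hk₀.le hδ)
  simp only [hsum, mul_le_mul_iff_right₀ hk₀] at h
  convert h using 3
  simp only [Finset.sum_const, Finset.card_univ, Fintype.card_fin, nsmul_eq_mul, NNReal.coe_mul,
    NNReal.coe_natCast, NNReal.coe_pow, NNReal.coe_div, coe_nnnorm, Real.norm_eq_abs, div_pow,
    sq_abs, NNReal.coe_ofNat]
  field_simp

lemma exists_sample_abs_mean_sub_integral_le {ι : Type*} [Fintype ι] {f : ι → X → ℝ}
    (hf : ∀ i, Measurable (f i)) {a b : ℝ} (hab : ∀ i x, f i x ∈ Set.Icc a b) {k : ℕ} (hk : 0 < k)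
    {δ : ℝ} (hδ : 0 ≤ δ)
    (hcard : Fintype.card ι * (2 * Real.exp (-(2 * k * δ ^ 2) / (b - a) ^ 2)) < 1) :
    ∃ ω : Fin k → X, ∀ i, |(∑ t, f i (ω t)) / k - ∫ x, f i x ∂ν| ≤ δ := by
  by_contra! hbad
  refine hcard.not_ge ?_
  let B (i : ι) : Set (Fin k → X) := {ω | δ ≤ |(∑ t, f i (ω t)) / k - ∫ x, f i x ∂ν|}
  calc 1 = (Measure.pi fun _ : Fin k => ν).real Set.univ := probReal_univ.symm
    _ ≤ (Measure.pi fun _ : Fin k => ν).real (⋃ i, B i) := measureReal_mono fun ω _ =>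
        Set.mem_iUnion.2 ((hbad ω).imp fun _ => le_of_lt)
    _ ≤ ∑ i, (Measure.pi fun _ : Fin k => ν).real (B i) := measureReal_iUnion_fintype_le _
    _ ≤ ∑ _ : ι, 2 * Real.exp (-(2 * k * δ ^ 2) / (b - a) ^ 2) := Finset.sum_le_sum fun i _ =>
        measureReal_le_abs_mean_sub_integral_le ν (hf i) (hab i) hk hδ
    _ = _ := by rw [Finset.sum_const, Finset.card_univ, nsmul_eq_mul]

end Sampling

section PureProfiles

open MeasureTheory

variable {n m k : ℕ} {s : Assignment n m}

/-- The profile in which every player `i` plays the pure strategy `x i`. -/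
def pureProfile (x : Fin n → Fin m) : Assignment n m :=
  fun i => Pi.single (x i) 1

lemma isProfile_pureProfile (x : Fin n → Fin m) : IsProfile (pureProfile x) :=
  fun i => single_mem_stdSimplex ℝ (x i)

lemma isKUniform_average_pureProfile (ω : Fin k → Fin n → Fin m) (i : Fin n) :
    IsKUniform k (((k : ℝ)⁻¹ • ∑ t, pureProfile (ω t)) i) := by
  refine ⟨Finset.univ.val.map fun t => ω t i, by simp, fun l => ?_⟩
  simp only [Pi.smul_apply, Finset.sum_apply, pureProfile, Pi.single_apply, Finset.sum_boole,
    smul_eq_mul, Multiset.count_map, div_eq_inv_mul]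
  rfl

lemma isKUniform_pureProfile (hk : 0 < k) (x : Fin n → Fin m) (i : Fin n) :
    IsKUniform k (pureProfile x i) := by
  have h := isKUniform_average_pureProfile (fun _ : Fin k => x) i
  have hk₀ : (k : ℝ) ≠ 0 := by positivity
  rwa [Finset.sum_const, Finset.card_univ, Fintype.card_fin, ← Nat.cast_smul_eq_nsmul ℝ,
    inv_smul_smul₀ hk₀] at h

lemma exists_measure_integral_single_eq {ι : Type*} [Fintype ι] [DecidableEq ι]
    [MeasurableSpace ι] [MeasurableSingletonClass ι] {σ : ι → ℝ} (hσ : σ ∈ stdSimplex ℝ ι) :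
    ∃ ν : Measure ι, IsProbabilityMeasure ν ∧ ∫ a, (Pi.single a 1 : ι → ℝ) ∂ν = σ := by
  have hsum : ∑ a, ENNReal.ofReal (σ a) = 1 := by
    rw [← ENNReal.ofReal_sum_of_nonneg fun a _ => hσ.1 a, hσ.2, ENNReal.ofReal_one]
  refine ⟨(PMF.ofFintype _ hsum).toMeasure, inferInstance, ?_⟩
  rw [PMF.integral_eq_sum]
  refine (Finset.sum_congr rfl fun a _ => ?_).trans (Finset.univ_sum_single σ)
  rw [PMF.ofFintype_apply, ENNReal.toReal_ofReal (hσ.1 a), ← Pi.single_smul, smul_eq_mul, mul_one]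

lemma exists_measure_integral_pureProfile_eq (hs : IsProfile s) :
    ∃ ν : Measure (Fin n → Fin m), IsProbabilityMeasure ν ∧ ∫ x, pureProfile x ∂ν = s := by
  choose ν hν hνs using fun i => exists_measure_integral_single_eq (hs i)
  refine ⟨Measure.pi ν, inferInstance, funext fun i => ?_⟩
  rw [eval_integral fun _ => Integrable.of_finite]
  exact (integral_comp_eval (measurable_of_finite _).aestronglyMeasurable).trans (hνs i)

lemma exists_isKUniform_abs_sub_le {ι : Type*} [Fintype ι] {f : ι → Assignment n m → ℝ}
    (hf : ∀ a, IsLinearMap ℝ (f a)) (hf01 : ∀ a x, f a (pureProfile x) ∈ Set.Icc 0 1)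
    (hs : IsProfile s) (hk : 0 < k) {δ : ℝ} (hδ : 0 ≤ δ)
    (hcard : Fintype.card ι * (2 * Real.exp (-(2 * k * δ ^ 2))) < 1) :
    ∃ s₁ : Assignment n m, (∀ i, IsKUniform k (s₁ i)) ∧ ∀ a, |f a s₁ - f a s| ≤ δ := by
  obtain ⟨ν, hν, hνs⟩ := exists_measure_integral_pureProfile_eq hs
  obtain ⟨ω, hω⟩ := exists_sample_abs_mean_sub_integral_le ν
    (f := fun a x => f a (pureProfile x)) (fun a => measurable_of_finite _) hf01 hk hδ
    (by rwa [sub_zero, one_pow, div_one])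
  refine ⟨(k : ℝ)⁻¹ • ∑ t, pureProfile (ω t), isKUniform_average_pureProfile ω, fun a => ?_⟩
  let L := (hf a).mk'
  have hmean : L ((k : ℝ)⁻¹ • ∑ t, pureProfile (ω t)) = (∑ t, L (pureProfile (ω t))) / k := by
    rw [map_smul, map_sum, smul_eq_mul, inv_mul_eq_div]
  have hint : ∫ x, L (pureProfile x) ∂ν = L s := by
    rw [← hνs]
    exact L.toContinuousLinearMap.integral_comp_comm Integrable.of_finite
  change |L _ - L s| ≤ δ
  rw [hmean, ← hint]
  exact hω a

end PureProfiles

/-! ### Uniform approximate equilibria -/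

section Numerics

lemma exp_neg_le_inv_pow {x y : ℝ} (hy : 0 < y) {r : ℕ} (h : r * Real.log y ≤ x) :
    Real.exp (-x) ≤ (y ^ r)⁻¹ := by
  rw [Real.exp_neg, ← Real.exp_log (pow_pos hy r), Real.log_pow]
  exact inv_anti₀ (Real.exp_pos _) (Real.exp_le_exp.2 h)

lemma four_mul_lt_pow_four {y : ℝ} (hy : 2 ≤ y) : 4 * y < y ^ 4 := by
  have hcube : (2 : ℝ) ^ 3 ≤ y ^ 3 := pow_le_pow_left₀ zero_le_two hy 3
  calc 4 * y < 2 ^ 3 * y := by linarith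
    _ ≤ y ^ 3 * y := mul_le_mul_of_nonneg_right hcube (by linarith)
    _ = y ^ 4 := (pow_succ y 3).symm

lemma card_mul_exp_lt_one {n m k : ℕ} (hm : 2 ≤ m) {ε : ℝ} (hε : 0 < ε) (hε₈ : ε < 8)
    (hk : 128 * (Real.log m + Real.log n - Real.log ε + Real.log 8) / ε ^ 2 ≤ k) :
    (n * (m + 1) : ℝ) * (2 * Real.exp (-(2 * k * (ε / 8) ^ 2))) < 1 := by
  rcases n.eq_zero_or_pos with rfl | hn
  · simp
  have hn₁ : (1 : ℝ) ≤ n := by exact_mod_cast hn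
  have hm₂ : (2 : ℝ) ≤ m := by exact_mod_cast hm
  set y : ℝ := m * n / ε * 8 with hy
  have hlog : Real.log m + Real.log n - Real.log ε + Real.log 8 = Real.log y := by
    rw [hy, Real.log_mul (by positivity) (by norm_num), Real.log_div (by positivity) hε.ne',
      Real.log_mul (by positivity) (by positivity)]
  rw [hlog, div_le_iff₀ (by positivity)] at hk
  have hmn : (2 : ℝ) ≤ m * n := by nlinarith
  have hmny : (m * n : ℝ) ≤ y := by
    rw [hy, div_mul_eq_mul_div, le_div_iff₀ hε]
    exact mul_le_mul_of_nonneg_left hε₈.le (by positivity)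
  have hy₀ : 0 < y := by linarith
  have hexp : Real.exp (-(2 * k * (ε / 8) ^ 2)) ≤ (y ^ 4)⁻¹ :=
    exp_neg_le_inv_pow hy₀ (by push_cast; linarith)
  have hcard : (n * (m + 1) : ℝ) * 2 ≤ 4 * y := by nlinarith
  calc (n * (m + 1) : ℝ) * (2 * Real.exp (-(2 * k * (ε / 8) ^ 2)))
      ≤ (n * (m + 1) : ℝ) * (2 * (y ^ 4)⁻¹) := by gcongr
    _ = (n * (m + 1) : ℝ) * 2 / y ^ 4 := by ring
    _ < 1 := (div_lt_one (pow_pos hy₀ 4)).2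
        (hcard.trans_lt (four_mul_lt_pow_four (hmn.trans hmny)))

end Numerics

namespace PolymatrixGame

variable {n m k : ℕ} {G : PolymatrixGame n m} {s s' : Assignment n m} {ε δ η : ℝ}

lemma isLinearMap_purePayoff (G : PolymatrixGame n m) (i : Fin n) (l : Fin m) :
    IsLinearMap ℝ fun s => G.purePayoff s i l where
  map_add s s' := by
    simp only [purePayoff, payoffFrom, Finset.sum_apply, Pi.add_apply, Matrix.mulVec_add,
      Finset.sum_add_distrib]
  map_smul a s := by
    simp only [purePayoff, payoffFrom, Finset.sum_apply, Pi.smul_apply, Matrix.mulVec_smul,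
      Finset.smul_sum]

lemma IsNormalised.dotProduct_purePayoff_mem_Icc (hG : G.IsNormalised) (hs : IsProfile s)
    {σ : Fin m → ℝ} (hσ : σ ∈ stdSimplex ℝ (Fin m)) (i : Fin n) :
    σ ⬝ᵥ G.purePayoff s i ∈ Set.Icc 0 1 :=
  (convex_Icc 0 1).sum_mem (fun l _ => hσ.1 l) hσ.2 fun l _ => hG s hs i l

lemma exists_isKUniform_close_of_card_mul_exp_lt (hG : G.IsNormalised) (hs : IsProfile s)
    (hk : 0 < k) (hδ : 0 ≤ δ)
    (hcard : (n * (m + 1) : ℝ) * (2 * Real.exp (-(2 * k * δ ^ 2))) < 1) :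
    ∃ s₁ : Assignment n m, (∀ i, IsKUniform k (s₁ i)) ∧
      (∀ i l, |G.purePayoff s₁ i l - G.purePayoff s i l| ≤ δ) ∧
      ∀ i, |G.expectedPayoff s₁ i - G.expectedPayoff s i| ≤ 2 * δ := by
  let f : Fin n × Option (Fin m) → Assignment n m → ℝ
    | (i, none), σ => σ i ⬝ᵥ G.purePayoff s i
    | (i, some l), σ => G.purePayoff σ i l
  have hf : ∀ a, IsLinearMap ℝ (f a)
    | (i, none) => ⟨fun _ _ => add_dotProduct _ _ _, fun a σ => smul_dotProduct a (σ i) _⟩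
    | (i, some l) => G.isLinearMap_purePayoff i l
  have hf01 : ∀ a x, f a (pureProfile x) ∈ Set.Icc 0 1
    | (i, none), x => hG.dotProduct_purePayoff_mem_Icc hs (isProfile_pureProfile x i) i
    | (i, some l), x => hG _ (isProfile_pureProfile x) i l
  obtain ⟨s₁, hs₁, hclose⟩ := exists_isKUniform_abs_sub_le hf hf01 hs hk hδ
    (by simpa [Fintype.card_prod, Fintype.card_option] using hcard)
  have hpure (i : Fin n) (l : Fin m) : |G.purePayoff s₁ i l - G.purePayoff s i l| ≤ δ :=
    hclose (i, some l)
  refine ⟨s₁, hs₁, hpure, fun i => ?_⟩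
  calc |G.expectedPayoff s₁ i - G.expectedPayoff s i|
      ≤ |G.expectedPayoff s₁ i - s₁ i ⬝ᵥ G.purePayoff s i| +
        |s₁ i ⬝ᵥ G.purePayoff s i - G.expectedPayoff s i| := abs_sub_le _ _ _
    _ ≤ δ + δ := add_le_add (abs_dotProduct_sub_le ((hs₁ i).mem_stdSimplex hk) (hpure i))
        (hclose (i, none))
    _ = 2 * δ := (two_mul δ).symm

lemma exists_isKUniform_close (hG : G.IsNormalised) (hs : IsProfile s) (hε : 0 < ε) (hk : 0 < k)
    (hkε : 128 * (Real.log m + Real.log n - Real.log ε + Real.log 8) / ε ^ 2 ≤ k) :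
    ∃ s₁ : Assignment n m, (∀ i, IsKUniform k (s₁ i)) ∧
      (∀ i l, |G.purePayoff s₁ i l - G.purePayoff s i l| ≤ ε / 8) ∧
      ∀ i, |G.expectedPayoff s₁ i - G.expectedPayoff s i| ≤ ε / 4 := by
  choose x _ using fun i => Finset.nonempty_of_sum_ne_zero ((hs i).2.trans_ne one_ne_zero)
  have hx := isProfile_pureProfile x
  -- The union bound needs `2 ≤ m` and `ε < 8`. Otherwise the profile is unique or any one will do.
  rcases le_or_gt 8 ε with hε₈ | hε₈
  · exact ⟨_, isKUniform_pureProfile hk x,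
      fun i l => (Real.dist_le_of_mem_Icc_01 (hG _ hx i l) (hG s hs i l)).trans (by linarith),
      fun i => (Real.dist_le_of_mem_Icc_01 (hG.dotProduct_purePayoff_mem_Icc hx (hx i) i)
        (hG.dotProduct_purePayoff_mem_Icc hs (hs i) i)).trans (by linarith)⟩
  rcases Nat.lt_or_ge m 2 with hm | hm
  · have : Subsingleton (Fin m) := Fin.subsingleton_iff_le_one.2 (Nat.le_of_lt_succ hm)
    have hsx : pureProfile x = s := funext fun i =>
      congrArg Subtype.val (Subsingleton.elim (⟨_, hx i⟩ : stdSimplex ℝ (Fin m)) ⟨_, hs i⟩)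
    refine ⟨s, hsx ▸ isKUniform_pureProfile hk x, fun i l => ?_, fun i => ?_⟩ <;>
    · rw [sub_self, abs_zero]
      positivity
  · rw [show ε / 4 = 2 * (ε / 8) by ring]
    exact exists_isKUniform_close_of_card_mul_exp_lt hG hs hk (by positivity)
      (card_mul_exp_lt_one hm hε hε₈ hkε)

lemma IsApproxNE.of_close (hs : G.IsApproxNE ε s) (hs' : IsProfile s')
    (hpure : ∀ i l, |G.purePayoff s' i l - G.purePayoff s i l| ≤ δ)
    (hexpected : ∀ i, |G.expectedPayoff s' i - G.expectedPayoff s i| ≤ η) :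
    G.IsApproxNE (ε + δ + η) s' := by
  refine ⟨hs', fun i l => ?_⟩
  linarith [(abs_le.1 (hpure i l)).2, (abs_le.1 (hexpected i)).1, hs.2 i l]

lemma abs_linearPayoff_sub_le (c : Fin n → ℝ) (d : Fin n → Fin m → ℝ)
    (hpure : ∀ i l, |G.purePayoff s i l - G.purePayoff s' i l| ≤ η)
    (hexpected : ∀ i, |G.expectedPayoff s i - G.expectedPayoff s' i| ≤ η) :
    |G.linearPayoff c d s - G.linearPayoff c d s'| ≤ (∑ i, (|c i| + ∑ l, |d i l|)) * η := by
  have hmul {x y : ℝ} (a : ℝ) (h : |x - y| ≤ η) : |a * x - a * y| ≤ |a| * η := by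
    rw [← mul_sub, abs_mul]
    exact mul_le_mul_of_nonneg_left h (abs_nonneg a)
  have hd (i : Fin n) : |∑ l, d i l * G.purePayoff s i l - ∑ l, d i l * G.purePayoff s' i l| ≤
      (∑ l, |d i l|) * η := by
    rw [← Finset.sum_sub_distrib, Finset.sum_mul]
    exact (Finset.abs_sum_le_sum_abs _ _).trans
      (Finset.sum_le_sum fun l _ => hmul (d i l) (hpure i l))
  unfold linearPayoff
  rw [← Finset.sum_sub_distrib, Finset.sum_mul]
  refine (Finset.abs_sum_le_sum_abs _ _).trans (Finset.sum_le_sum fun i _ => ?_)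
  rw [add_sub_add_comm, add_mul]
  exact (abs_add_le _ _).trans (add_le_add (hmul (c i) (hexpected i)) (hd i))

lemma exists_isKUniform_isApproxNE (hG : G.IsNormalised) (c : Fin n → ℝ) (d : Fin n → Fin m → ℝ)
    (hε : 0 < ε) (hk : 0 < k)
    (hkε : 128 * (Real.log m + Real.log n - Real.log ε + Real.log 8) / ε ^ 2 ≤ k)
    (hs : G.IsApproxNE (ε / 8) s) :
    ∃ s₁, (∀ i, IsKUniform k (s₁ i)) ∧ G.IsApproxNE (ε / 2) s₁ ∧
      |G.linearPayoff c d s₁ - G.linearPayoff c d s| ≤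
        (∑ i, (|c i| + ∑ l, |d i l|)) * (ε / 4) := by
  obtain ⟨s₁, hs₁, hpure, hexpected⟩ := exists_isKUniform_close hG hs.1 hε hk hkε
  refine ⟨s₁, hs₁, ?_, abs_linearPayoff_sub_le c d
    (fun i l => (hpure i l).trans (by linarith)) hexpected⟩
  convert hs.of_close (fun i => (hs₁ i).mem_stdSimplex hk) hpure hexpected using 1
  ring

end PolymatrixGame

theorem mainTheorem6 :
    (∀ (n m : ℕ) (G : PolymatrixGame n m) (c : Fin n → ℝ) (d : Fin n → Fin m → ℝ),
      ∃ K : OVDConstraint G, K.IsLinear c d) ∧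
    ∃ C : ℝ, ∀ (n m : ℕ) (_ : 0 < m) (G : PolymatrixGame n m) (_ : G.IsNormalised)
      (c : Fin n → ℝ) (d : Fin n → Fin m → ℝ) (K : OVDConstraint G) (_ : K.IsLinear c d)
      (t : NiceTree n) (_ : t.IsNiceTreeDecomposition G.graph) (_ : t.bag = ∅)
      (ε : ℝ) (_ : 0 < ε) (k : ℕ) (_ : 0 < k)
      (_ : 128 * (Real.log m + Real.log n - Real.log ε + Real.log 8) / ε ^ 2 ≤ k),
      (∀ s, ConstrainedAlgorithm.Returns K ε k t s →
        G.IsApproxNE (3 / 2 * ε) s ∧ ∀ i, IsKUniform k (s i)) ∧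
      ∀ s', G.IsApproxNE (ε / 8) s' →
        (∃ s, ConstrainedAlgorithm.Returns K ε k t s) ∧
        ∀ s, ConstrainedAlgorithm.Returns K ε k t s →
          K.value Finset.univ s ≥
            K.value Finset.univ s' - C * (∑ i, (|c i| + ∑ l, |d i l|)) * ε := by
  refine ⟨fun n m G c d => ⟨OVDConstraint.linear G c d, OVDConstraint.linear_isLinear G c d⟩,
    1 / 4, fun n m _ G hG c d K hK t ht hbag ε hε k hk hkε =>
      ⟨fun s h => ⟨h.isApproxNE ht hbag hε hk, h.isKUniform ht hbag⟩, fun s' hs' => ?_⟩⟩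
  obtain ⟨s₁, hs₁k, hs₁, hclose⟩ :=
    PolymatrixGame.exists_isKUniform_isApproxNE hG c d hε hk hkε hs'
  refine ⟨ConstrainedAlgorithm.exists_returns hε hk ht.isPartialDecomposition hK.isMonotone
    hs₁ hs₁k, fun s h => ?_⟩
  have hbest := ConstrainedAlgorithm.value_le_of_returns ht hbag hε hk hK.isMonotone hs₁ hs₁k h
  rw [hK.value_univ hs₁.1] at hbest
  rw [hK.value_univ hs'.1]
  linarith [(abs_le.1 hclose).1]
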